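/- For a convex body $K\subset\mathbb{R}^n$ (a compact convex set with non-empty interior) let $|K|$ be its volume, $S(K)$ its surface area (the $(n-1)$-dimensional Hausdorff measure of its boundary, normalized to agree with Lebesgue measure on $\mathbb{R}^{n-1}$), $w(K)=\int_{S^{n-1}}h_K(\xi)\,d\sigma(\xi)$ its mean width, where $h_K(y)=\max\{\langle x,y\rangle : x\in K\}$ is the support function and $\sigma$ is the rotationally invariant probability measure on the unit sphere $S^{n-1}$, and put $$q(K)=\frac{w(K)\,S(K)}{|K|}.$$ Let $n\ge 2$. Then: 1. $q(K)\ge n$ for every convex body $K$ in $\mathbb{R}^n$, and $q(B_2^n)=n$ for the Euclidean unit ball $B_2^n$. 2. $\sup\{q(K): K \text{ is a centrally symmetric convex body in } \mathbb{R}^n\}=+\infty$, where centrally symmetric means that $x\in K$ implies $-x\in K$. More precisely, for $0<a<1$ let $\mathcal{E}_a=\{x\in\mathbb{R}^n: \sum_{i=1}^{n} x_i^2/a_i^2\le 1\}$ be the ellipsoid with semi-axes $a_1=\dots=a_{n-1}=a$ and $a_n=1/a^{n-1}$. Each $\mathcal{E}_a$ is a centrally symmetric convex body, and $q(\mathcal{E}_a)\to+\infty$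 as $a\to 0^+$. -/

import Mathlib

open MeasureTheory Set Filter Topology

namespace QParam

/-- A convex body in `ℝⁿ`: a compact convex set with non-empty interior. -/
structure IsConvexBody {n : ℕ} (K : Set (EuclideanSpace ℝ (Fin n))) : Prop where
  convex : Convex ℝ K
  isCompact : IsCompact K
  nonempty_interior : (interior K).Nonempty

/-- `K` is centrally symmetric (about the origin). -/
def IsCentrallySymmetric {n : ℕ} (K : Set (EuclideanSpace ℝ (Fin n))) : Prop :=
  ∀ x ∈ K, -x ∈ K

/-- The support function `h_K(y) = max {⟨x, y⟩ : x ∈ K}`. -/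
noncomputable def supportFunction {n : ℕ} (K : Set (EuclideanSpace ℝ (Fin n)))
    (y : EuclideanSpace ℝ (Fin n)) : ℝ :=
  sSup ((fun x => inner ℝ x y) '' K)

/-- The mean width `w(K) = ∫ h_K dσ`, where `σ` is the rotationally invariant probability measure
on the unit sphere, that is, the spherical measure divided by its total mass. -/
noncomputable def meanWidth {n : ℕ} (K : Set (EuclideanSpace ℝ (Fin n))) : ℝ :=
  ⨍ ξ : Metric.sphere (0 : EuclideanSpace ℝ (Fin n)) 1,
    supportFunction K ξ ∂(volume : Measure (EuclideanSpace ℝ (Fin n))).toSphere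

/-- The surface area `S(K)`: the `(n-1)`-dimensional Hausdorff measure of the boundary of `K`,
normalized so as to agree with Lebesgue measure on `ℝⁿ⁻¹`. -/
noncomputable def surfaceArea {n : ℕ} (K : Set (EuclideanSpace ℝ (Fin n))) : ℝ :=
  (Measure.euclideanHausdorffMeasure (n - 1) : Measure (EuclideanSpace ℝ (Fin n))).real
    (frontier K)

/-- The parameter `q(K) = w(K) S(K) / |K|`. -/
noncomputable def q {n : ℕ} (K : Set (EuclideanSpace ℝ (Fin n))) : ℝ :=
  meanWidth K * surfaceArea K / (volume : Measure (EuclideanSpace ℝ (Fin n))).real K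

/-- The origin-symmetric ellipsoid with semi-axes of lengths `a i` in the coordinate directions
(meant for positive `a i`). -/
def ellipsoid {n : ℕ} (a : Fin n → ℝ) : Set (EuclideanSpace ℝ (Fin n)) :=
  {x | ∑ i, (x i / a i) ^ 2 ≤ 1}

/-- The semi-axes `a, …, a, 1 / aⁿ⁻¹`, whose product is `1`. -/
noncomputable def elongatedAxes (n : ℕ) (a : ℝ) (i : Fin n) : ℝ :=
  if (i : ℕ) + 1 = n then 1 / a ^ (n - 1) else a

end QParam

/-!
Let `r` be the radius of the ball with the volume of the convex body `K ⊆ ℝⁿ`. The lower bound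
`q K ≥ n` is the product of the isoperimetric inequality `n |K| ≤ r S(K)` (`isoperimetric`) and
Urysohn's inequality `r ≤ w(K)` (`urysohn`). Both rest on the Brunn–Minkowski inequality
`|(1 - t) A + t B| ≥ |A| ^ (1 - t) |B| ^ t` (`brunn_minkowski`), which is obtained from the
Prékopa–Leindler inequality by induction on the dimension.

The surface area is a Hausdorff measure, so the isoperimetric inequality is first proved for
polytopes, where that measure is accessible through Fubini's theorem. A point of a polytope `P` at
distance less than `t` from the boundary projects orthogonally onto its nearest facet, so moving all
facets inward by `t` loses volume at most `t S(P)` (`volume_polyhedron_le`); Brunn–Minkowski bounds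
the loss from below (`volume_inner_parallel_le`). The general case follows from two facts: a convex
body contains polytopes of almost the same volume (`exists_inscribed_polyhedron`), and surface area
is monotone under inclusion of convex bodies (`measure_frontier_mono`), since following the outer
normals of the smaller body to the boundary of the larger one does not decrease distances. The same
monotonicity applied to polytopes circumscribed about the unit ball `B`, whose volume is `1 / n`
times their surface area, gives `S(B) ≤ n |B|` (`measure_frontier_closedBall_one_le`), hence
`q B = n`.

For Urysohn's inequality, `(1 - t) B + t r⁻¹ K` reaches in the direction `θ` at most to
`1 - t + t h_K(θ) / r`. Its volume in polar coordinates is therefore at most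
`n⁻¹ ∫ (1 - t + t h_K / r) ^ n`, while Brunn–Minkowski makes it at least `|B|`; the terms of first
order in `t` give the claim.

An ellipsoid with semi-axes `a i` has volume at most `2 ^ n ∏ a i` and mean width at least
`a i ⨍ |ξ i|`. When the product of the semi-axes is `1`, the isoperimetric inequality bounds
`S / |E|` below by a positive constant, and one long semi-axis makes `q` large.
-/

open scoped ENNReal NNReal Pointwise

namespace QParam

/-! ### The Prékopa–Leindler and Brunn–Minkowski inequalities -/

/-- Weighted arithmetic-geometric mean inequality for two extended nonnegative reals. -/
theorem ennreal_geom_mean_le_arith_mean {l : ℝ} (h0 : 0 < l) (h1 : l < 1) (x y : ℝ≥0∞) :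
    x ^ (1 - l) * y ^ l ≤ ENNReal.ofReal (1 - l) * x + ENNReal.ofReal l * y := by
  have hl : 0 < 1 - l := by linarith
  have hpq : ((1 - l)⁻¹).HolderConjugate l⁻¹ := by
    constructor
    · simp
    · positivity
    · positivity
  have h := ENNReal.young_inequality (x ^ (1 - l)) (y ^ l) hpq
  rw [← ENNReal.rpow_mul, ← ENNReal.rpow_mul, mul_inv_cancel₀ hl.ne', mul_inv_cancel₀ h0.ne',
    ENNReal.rpow_one, ENNReal.rpow_one, ENNReal.ofReal_inv_of_pos hl,
    ENNReal.ofReal_inv_of_pos h0, div_eq_mul_inv, div_eq_mul_inv, inv_inv, inv_inv] at h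
  rwa [mul_comm (ENNReal.ofReal (1 - l)), mul_comm (ENNReal.ofReal l)]

/-- One-dimensional Brunn–Minkowski for compact sets: `A + B` contains a translate of `A` and a
translate of `B` that meet in a single point. -/
theorem volume_add_volume_le_of_isCompact {A B C : Set ℝ} (hA : IsCompact A) (hB : IsCompact B)
    (hA0 : A.Nonempty) (hB0 : B.Nonempty) (hC : ∀ x ∈ A, ∀ y ∈ B, x + y ∈ C) :
    volume A + volume B ≤ volume C := by
  obtain ⟨a, ha, hamax⟩ := hA.exists_isGreatest hA0
  obtain ⟨b, hb, hbmin⟩ := hB.exists_isLeast hB0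
  have h1 : volume A = volume ((fun x => x + b) '' A) := by simp
  have h2 : volume B = volume ((fun x => a + x) '' B) := by simp
  have hmB : MeasurableSet ((fun x => a + x) '' B) :=
    (hB.image (by fun_prop)).measurableSet
  have hd : AEDisjoint volume ((fun x => x + b) '' A) ((fun x => a + x) '' B) := by
    refine measure_mono_null (t := {a + b}) ?_ (by simp)
    rintro _ ⟨⟨x, hx, rfl⟩, ⟨y, hy, hxy⟩⟩
    have := hamax hx
    have := hbmin hy
    simp only [mem_singleton_iff] at *
    linarith
  rw [h1, h2, ← measure_union₀ hmB.nullMeasurableSet hd]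
  refine measure_mono ?_
  rintro _ (⟨x, hx, rfl⟩ | ⟨y, hy, rfl⟩)
  exacts [hC x hx b hb, hC a ha y hy]

/-- One-dimensional Brunn–Minkowski inequality for measurable sets. -/
theorem volume_add_volume_le_of_measurableSet {A B C : Set ℝ} (hA : MeasurableSet A)
    (hB : MeasurableSet B) (hA0 : A.Nonempty) (hB0 : B.Nonempty)
    (hC : ∀ x ∈ A, ∀ y ∈ B, x + y ∈ C) :
    volume A + volume B ≤ volume C := by
  obtain ⟨a, ha⟩ := hA0
  obtain ⟨b, hb⟩ := hB0
  have sup_compact : ∀ {S : Set ℝ}, MeasurableSet S →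
      volume S = ⨆ K ∈ {K | K ⊆ S ∧ IsCompact K}, volume K := by
    intro S hS
    simp only [hS.measure_eq_iSup_isCompact, mem_ofPred_eq, iSup_and]
  rw [sup_compact hA, sup_compact hB]
  refine ENNReal.biSup_add_biSup_le (s := {K | K ⊆ A ∧ IsCompact K})
    (t := {K | K ⊆ B ∧ IsCompact K}) ⟨∅, empty_subset _, isCompact_empty⟩
    ⟨∅, empty_subset _, isCompact_empty⟩ ?_
  rintro A' ⟨hA', hcA⟩ B' ⟨hB', hcB⟩
  refine le_trans (add_le_add (measure_mono (subset_insert a A'))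
    (measure_mono (subset_insert b B'))) ?_
  refine volume_add_volume_le_of_isCompact (hcA.insert a) (hcB.insert b)
    (insert_nonempty _ _) (insert_nonempty _ _) fun x hx y hy => hC x ?_ y ?_
  · exact insert_subset ha hA' hx
  · exact insert_subset hb hB' hy

/-- The additive form of the one-dimensional Prékopa–Leindler inequality for functions normalized
to have supremum `1`: compare superlevel sets and integrate over the levels. -/
theorem lintegral_superlevel_add_le {l : ℝ} (h0 : 0 < l) (h1 : l < 1) {F G H : ℝ → ℝ}
    (hF : Measurable F) (hG : Measurable G) (hH : Measurable H)
    (hF0 : ∀ x, 0 ≤ F x) (hG0 : ∀ x, 0 ≤ G x) (hH0 : ∀ x, 0 ≤ H x)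
    (hF1 : ∀ x, F x ≤ 1) (hG1 : ∀ x, G x ≤ 1)
    (hF2 : ∀ t, 0 < t → t < 1 → ∃ x, t < F x) (hG2 : ∀ t, 0 < t → t < 1 → ∃ x, t < G x)
    (hFGH : ∀ t, 0 < t → t < 1 → ∀ x y, t < F x → t < G y → t < H ((1 - l) * x + l * y)) :
    ENNReal.ofReal (1 - l) * (∫⁻ x, ENNReal.ofReal (F x)) +
      ENNReal.ofReal l * (∫⁻ x, ENNReal.ofReal (G x)) ≤ ∫⁻ x, ENNReal.ofReal (H x) := by
  have hl : 0 < 1 - l := by linarith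
  rw [lintegral_eq_lintegral_meas_lt volume (Eventually.of_forall hF0) hF.aemeasurable,
    lintegral_eq_lintegral_meas_lt volume (Eventually.of_forall hG0) hG.aemeasurable,
    lintegral_eq_lintegral_meas_lt volume (Eventually.of_forall hH0) hH.aemeasurable,
    ← lintegral_const_mul' _ _ ENNReal.ofReal_ne_top,
    ← lintegral_const_mul' _ _ ENNReal.ofReal_ne_top]
  refine (le_lintegral_add _ _).trans (setLIntegral_mono' measurableSet_Ioi fun t ht => ?_)
  rw [mem_Ioi] at ht
  rcases lt_or_ge t 1 with ht1 | ht1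
  · have key : volume ((1 - l) • {a | t < F a}) + volume (l • {a | t < G a}) ≤
        volume {a | t < H a} := by
      refine volume_add_volume_le_of_measurableSet
        ((measurableSet_lt measurable_const hF).const_smul₀ _)
        ((measurableSet_lt measurable_const hG).const_smul₀ _)
        (Set.Nonempty.smul_set (hF2 t ht ht1)) (Set.Nonempty.smul_set (hG2 t ht ht1)) ?_
      rintro _ ⟨x, hx, rfl⟩ _ ⟨y, hy, rfl⟩
      exact hFGH t ht ht1 x y hx hy
    simpa [Measure.addHaar_smul, abs_of_pos hl, abs_of_pos h0] using key
  · have e1 : {a | t < F a} = ∅ := by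
      ext a; simpa using (hF1 a).trans ht1
    have e2 : {a | t < G a} = ∅ := by
      ext a; simpa using (hG1 a).trans ht1
    simp [e1, e2]

/-- One-dimensional Prékopa–Leindler inequality for bounded functions. -/
theorem prekopa_leindler_real_of_bounded {l : ℝ} (h0 : 0 < l) (h1 : l < 1) {f g h : ℝ → ℝ≥0∞}
    (hf : Measurable f) (hg : Measurable g) (hh : Measurable h)
    {M : ℝ≥0∞} (hM : M ≠ ∞) (hfM : ∀ x, f x ≤ M) (hgM : ∀ x, g x ≤ M)
    (hfgh : ∀ x y, f x ^ (1 - l) * g y ^ l ≤ h ((1 - l) * x + l * y)) :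
    (∫⁻ x, f x) ^ (1 - l) * (∫⁻ x, g x) ^ l ≤ ∫⁻ x, h x := by
  have hl : 0 < 1 - l := by linarith
  -- normalize both functions to have supremum `1`
  set a := ⨆ x, f x with ha
  set b := ⨆ x, g x with hb
  have haM : a ≠ ∞ := ((iSup_le hfM).trans_lt hM.lt_top).ne
  have hbM : b ≠ ∞ := ((iSup_le hgM).trans_lt hM.lt_top).ne
  rcases eq_or_ne a 0 with ha0 | ha0
  · have : ∀ x, f x = 0 := fun x => le_antisymm (ha0 ▸ le_iSup f x) (zero_le)
    simp [this, hl]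
  rcases eq_or_ne b 0 with hb0 | hb0
  · have : ∀ x, g x = 0 := fun x => le_antisymm (hb0 ▸ le_iSup g x) (zero_le)
    simp [this, h0]
  set c := a ^ (1 - l) * b ^ l with hc
  have hc0 : c ≠ 0 := mul_ne_zero (by simp [ENNReal.rpow_eq_zero_iff, ha0, haM])
    (by simp [ENNReal.rpow_eq_zero_iff, hb0, hbM])
  have hcM : c ≠ ∞ := ENNReal.mul_ne_top (ENNReal.rpow_ne_top_of_nonneg hl.le haM)
    (ENNReal.rpow_ne_top_of_nonneg h0.le hbM)
  have hfa : ∀ x, f x / a ≤ 1 := fun x => ENNReal.div_le_of_le_mul (by simpa using le_iSup f x)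
  have hgb : ∀ x, g x / b ≤ 1 := fun x => ENNReal.div_le_of_le_mul (by simpa using le_iSup g x)
  have hfa' : ∀ x, f x / a ≠ ∞ := fun x => ((hfa x).trans_lt ENNReal.one_lt_top).ne
  have hgb' : ∀ x, g x / b ≠ ∞ := fun x => ((hgb x).trans_lt ENNReal.one_lt_top).ne
  have hhc' : ∀ x, min (h x / c) 1 ≠ ∞ := fun x =>
    ((min_le_right _ _).trans_lt ENNReal.one_lt_top).ne
  have hsup : ∀ (u : ℝ → ℝ≥0∞) (s : ℝ≥0∞), s = ⨆ x, u x → s ≠ 0 → s ≠ ∞ →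
      (∀ x, u x / s ≠ ∞) → ∀ t : ℝ, 0 < t → t < 1 → ∃ x, t < (u x / s).toReal := by
    intro u s hs hs0 hsM hfin t ht0 ht
    have h2 : ENNReal.ofReal t * s < s := by
      have : ENNReal.ofReal t < 1 := by simpa using ht
      calc _ < 1 * s := ENNReal.mul_lt_mul_left hs0 hsM this
        _ = s := one_mul s
    have h3 : ENNReal.ofReal t * s < ⨆ x, u x := by rwa [← hs]
    obtain ⟨x, hx⟩ := lt_iSup_iff.1 h3
    refine ⟨x, (ENNReal.ofReal_lt_iff_lt_toReal ht0.le (hfin x)).1 ?_⟩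
    rwa [ENNReal.lt_div_iff_mul_lt (Or.inl hs0) (Or.inl hsM)]
  have hdiv : ∀ x y : ℝ≥0∞, (x / a) ^ (1 - l) * (y / b) ^ l = x ^ (1 - l) * y ^ l / c := by
    intro x y
    rw [ENNReal.div_rpow_of_nonneg _ _ hl.le, ENNReal.div_rpow_of_nonneg _ _ h0.le, hc]
    simp only [div_eq_mul_inv]
    rw [ENNReal.mul_inv]
    · ring
    · simp [ENNReal.rpow_eq_zero_iff, ha0, haM]
    · simp [ENNReal.rpow_eq_top_iff, ha0, haM, hl]
  have key := lintegral_superlevel_add_le h0 h1 (F := fun x => (f x / a).toReal)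
    (G := fun x => (g x / b).toReal) (H := fun x => (min (h x / c) 1).toReal)
    (by fun_prop) (by fun_prop) (by fun_prop) (fun _ => ENNReal.toReal_nonneg)
    (fun _ => ENNReal.toReal_nonneg) (fun _ => ENNReal.toReal_nonneg)
    (fun x => ENNReal.toReal_mono ENNReal.one_ne_top (hfa x))
    (fun x => ENNReal.toReal_mono ENNReal.one_ne_top (hgb x))
    (hsup f a ha ha0 haM hfa') (hsup g b hb hb0 hbM hgb') (by
      intro t ht ht1 x y hx hy
      have hx' : ENNReal.ofReal t < f x / a := by
        rwa [ENNReal.ofReal_lt_iff_lt_toReal ht.le (hfa' x)]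
      have hy' : ENNReal.ofReal t < g y / b := by
        rwa [ENNReal.ofReal_lt_iff_lt_toReal ht.le (hgb' y)]
      rw [← ENNReal.ofReal_lt_iff_lt_toReal ht.le (hhc' _)]
      refine lt_min ?_ (by simpa using ht1)
      calc ENNReal.ofReal t = ENNReal.ofReal t ^ (1 - l) * ENNReal.ofReal t ^ l := by
            rw [← ENNReal.rpow_add _ _ (by simpa using ht) ENNReal.ofReal_ne_top]; simp
        _ < (f x / a) ^ (1 - l) * (g y / b) ^ l :=
            ENNReal.mul_lt_mul (ENNReal.rpow_lt_rpow hx' hl) (ENNReal.rpow_lt_rpow hy' h0)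
        _ = f x ^ (1 - l) * g y ^ l / c := hdiv _ _
        _ ≤ _ := by gcongr; exact hfgh x y)
  simp only [ENNReal.ofReal_toReal (hfa' _), ENNReal.ofReal_toReal (hgb' _),
    ENNReal.ofReal_toReal (hhc' _)] at key
  have key2 := (ennreal_geom_mean_le_arith_mean h0 h1 (∫⁻ x, f x / a) (∫⁻ x, g x / b)).trans
    (key.trans (lintegral_mono fun x => min_le_left (h x / c) 1))
  have int_div : ∀ (u : ℝ → ℝ≥0∞) (s : ℝ≥0∞), Measurable u →
      ∫⁻ x, u x / s = (∫⁻ x, u x) / s := fun u s hu => by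
    simp only [div_eq_mul_inv]
    exact lintegral_mul_const _ hu
  rw [int_div f a hf, int_div g b hg, int_div h c hh, hdiv] at key2
  calc _ = (∫⁻ x, f x) ^ (1 - l) * (∫⁻ x, g x) ^ l / c * c :=
        (ENNReal.div_mul_cancel hc0 hcM).symm
    _ ≤ (∫⁻ x, h x) / c * c := by gcongr
    _ = _ := ENNReal.div_mul_cancel hc0 hcM

/-- One-dimensional Prékopa–Leindler inequality. -/
theorem prekopa_leindler_real {l : ℝ} (h0 : 0 < l) (h1 : l < 1) {f g h : ℝ → ℝ≥0∞}
    (hf : Measurable f) (hg : Measurable g) (hh : Measurable h)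
    (hfgh : ∀ x y, f x ^ (1 - l) * g y ^ l ≤ h ((1 - l) * x + l * y)) :
    (∫⁻ x, f x) ^ (1 - l) * (∫⁻ x, g x) ^ l ≤ ∫⁻ x, h x := by
  have hl : 0 < 1 - l := by linarith
  -- truncate at height `k` and let `k` tend to infinity
  rcases eq_or_ne (∫⁻ x, f x) 0 with hf0 | hf0
  · simp [hf0, hl]
  rcases eq_or_ne (∫⁻ x, g x) 0 with hg0 | hg0
  · simp [hg0, h0]
  have lim : ∀ u : ℝ → ℝ≥0∞, Measurable u →
      Tendsto (fun k : ℕ => ∫⁻ x, min (u x) k) atTop (𝓝 (∫⁻ x, u x)) := by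
    intro u hu
    refine lintegral_tendsto_of_tendsto_of_monotone (fun k => by fun_prop)
      (Eventually.of_forall fun x k k' hk => ?_) (Eventually.of_forall fun x => ?_)
    · exact min_le_min le_rfl (by exact_mod_cast hk)
    · simpa using (tendsto_const_nhds (x := u x)).min ENNReal.tendsto_nat_nhds_top
  refine le_of_tendsto (ENNReal.Tendsto.mul
    (((ENNReal.continuous_rpow_const (y := 1 - l)).tendsto _).comp (lim f hf)) (Or.inl ?_)
    (((ENNReal.continuous_rpow_const (y := l)).tendsto _).comp (lim g hg)) (Or.inl ?_))
    (Eventually.of_forall fun k => ?_)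
  · simp [ENNReal.rpow_eq_zero_iff, hf0, h1.le]
  · simp [ENNReal.rpow_eq_zero_iff, hg0, h0.le]
  · refine prekopa_leindler_real_of_bounded h0 h1 (by fun_prop) (by fun_prop) hh
      (ENNReal.natCast_ne_top k) (fun x => min_le_right _ _) (fun x => min_le_right _ _)
      fun x y => le_trans ?_ (hfgh x y)
    gcongr <;> exact min_le_left _ _

/-- Prékopa–Leindler inequality on `ℝⁿ`, by induction on the dimension: integrating out all but
one coordinate preserves the hypothesis. -/
theorem prekopa_leindler {l : ℝ} (h0 : 0 < l) (h1 : l < 1) {n : ℕ} {f g h : (Fin n → ℝ) → ℝ≥0∞}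
    (hf : Measurable f) (hg : Measurable g) (hh : Measurable h)
    (hfgh : ∀ x y, f x ^ (1 - l) * g y ^ l ≤ h ((1 - l) • x + l • y)) :
    (∫⁻ x, f x) ^ (1 - l) * (∫⁻ x, g x) ^ l ≤ ∫⁻ x, h x := by
  induction n with
  | zero =>
    have e : ∀ u : (Fin 0 → ℝ) → ℝ≥0∞, ∫⁻ x, u x = u 0 := by
      intro u
      rw [volume_pi, Measure.pi_of_empty _ 0, lintegral_dirac]
    rw [e, e, e]
    simpa using hfgh 0 0
  | succ n ih =>
    have e := volume_preserving_piFinSuccAbove (fun _ : Fin (n + 1) => ℝ) 0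
    set c := (MeasurableEquiv.piFinSuccAbove (fun _ : Fin (n + 1) => ℝ) 0).symm with hc
    have hcm : Measurable c := c.measurable
    have hcs : ∀ s y, c (s, y) = Fin.cons s y := fun s y => by
      ext i
      refine Fin.cases ?_ (fun i => ?_) i <;> simp [hc, MeasurableEquiv.piFinSuccAbove]
    have split : ∀ u : (Fin (n + 1) → ℝ) → ℝ≥0∞, Measurable u →
        ∫⁻ x, u x = ∫⁻ s : ℝ, ∫⁻ y : Fin n → ℝ, u (c (s, y)) := by
      intro u hu
      rw [← e.symm.lintegral_comp_emb (MeasurableEquiv.measurableEmbedding _),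
        Measure.volume_eq_prod, lintegral_prod]
      exact (hu.comp hcm).aemeasurable
    rw [split f hf, split g hg, split h hh]
    refine prekopa_leindler_real h0 h1 (Measurable.lintegral_prod_right' (hf.comp hcm))
      (Measurable.lintegral_prod_right' (hg.comp hcm))
      (Measurable.lintegral_prod_right' (hh.comp hcm)) fun s t => ?_
    refine ih ((hf.comp hcm).comp measurable_prodMk_left)
      ((hg.comp hcm).comp measurable_prodMk_left)
      ((hh.comp hcm).comp measurable_prodMk_left) fun x y => ?_
    simp only [hcs]
    refine (hfgh _ _).trans (le_of_eq ?_)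
    congr 1
    ext i
    refine Fin.cases ?_ (fun i => ?_) i <;> simp

/-- Multiplicative Brunn–Minkowski inequality. The hypothesis that a measurable `C` contains the
Minkowski combination avoids the question whether that combination is measurable. -/
theorem brunn_minkowski {l : ℝ} (h0 : 0 < l) (h1 : l < 1) {n : ℕ}
    {A B C : Set (EuclideanSpace ℝ (Fin n))} (hA : MeasurableSet A) (hB : MeasurableSet B)
    (hC : MeasurableSet C) (hABC : ∀ x ∈ A, ∀ y ∈ B, (1 - l) • x + l • y ∈ C) :
    volume A ^ (1 - l) * volume B ^ l ≤ volume C := by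
  have hl : 0 < 1 - l := by linarith
  have e := PiLp.volume_preserving_toLp (Fin n)
  have vol : ∀ S : Set (EuclideanSpace ℝ (Fin n)), MeasurableSet S →
      volume S = ∫⁻ x : Fin n → ℝ, S.indicator 1 (WithLp.toLp 2 x) := by
    intro S hS
    rw [← lintegral_indicator_one hS, e.lintegral_comp (measurable_one.indicator hS)]
  rw [vol A hA, vol B hB, vol C hC]
  refine prekopa_leindler h0 h1 ((measurable_one.indicator hA).comp e.measurable)
    ((measurable_one.indicator hB).comp e.measurable)
    ((measurable_one.indicator hC).comp e.measurable) fun x y => ?_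
  by_cases hx : WithLp.toLp 2 x ∈ A
  · by_cases hy : WithLp.toLp 2 y ∈ B
    · have := hABC _ hx _ hy
      simp [hx, hy, this]
    · simp [hy, h0]
  · simp [hx, hl]

/-! ### Slicing by parallel hyperplanes -/

section Slices

variable {n : ℕ}

/-- Fubini's theorem for the slices orthogonal to a unit vector. -/
theorem volume_eq_lintegral_slice {u : EuclideanSpace ℝ (Fin n)} (hu : ‖u‖ = 1)
    {S : Set (EuclideanSpace ℝ (Fin n))} (hS : MeasurableSet S) :
    volume S = ∫⁻ s : ℝ, Measure.euclideanHausdorffMeasure (n - 1) (S ∩ {x | inner ℝ u x = s}) := by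
  have hu0 : u ≠ 0 := by rintro rfl; simp at hu
  have h := EuclideanGeometry.euclideanHausdorffMeasure_eq_lintegral
    (0 : EuclideanSpace ℝ (Fin n)) hu0 hS
  rw [finrank_euclideanSpace_fin, EuclideanSpace.euclideanHausdorffMeasure_eq_volume,
    ← ofReal_norm, hu, ENNReal.ofReal_one, one_mul] at h
  rw [h]
  refine lintegral_congr fun s => ?_
  congr 2
  ext x
  simp only [vadd_eq_add, add_zero, SetLike.mem_coe, AffineSubspace.mem_mk', vsub_eq_sub,
    Submodule.mem_orthogonal_singleton_iff_inner_right, inner_sub_right, inner_smul_right,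
    real_inner_self_eq_norm_sq, hu, mem_ofPred_eq]
  constructor <;> intro h <;> linarith

/-- The points that lie below a subset `A` of the hyperplane `⟨u, x⟩ = b`, at depth at most `t`. -/
def slabBelow (u : EuclideanSpace ℝ (Fin n)) (b t : ℝ) (A : Set (EuclideanSpace ℝ (Fin n))) :
    Set (EuclideanSpace ℝ (Fin n)) :=
  {x | inner ℝ u x ∈ Icc (b - t) b ∧ x + (b - inner ℝ u x) • u ∈ A}

theorem volume_slabBelow {u : EuclideanSpace ℝ (Fin n)} (hu : ‖u‖ = 1) {b t : ℝ}
    {A : Set (EuclideanSpace ℝ (Fin n))} (hA : MeasurableSet A) (hAb : ∀ x ∈ A, inner ℝ u x = b) :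
    volume (slabBelow u b t A) =
      ENNReal.ofReal t * Measure.euclideanHausdorffMeasure (n - 1) A := by
  have hm : MeasurableSet (slabBelow u b t A) := by
    refine (measurableSet_Icc.preimage (f := fun x => inner ℝ u x) (by fun_prop)).inter
      (hA.preimage (f := fun x => x + (b - inner ℝ u x) • u) (by fun_prop))
  rw [volume_eq_lintegral_slice hu hm]
  have hslice : ∀ s : ℝ, Measure.euclideanHausdorffMeasure (n - 1)
      (slabBelow u b t A ∩ {x | inner ℝ u x = s}) =
      (Icc (b - t) b).indicator (fun _ => Measure.euclideanHausdorffMeasure (n - 1) A) s := by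
    intro s
    by_cases hs : s ∈ Icc (b - t) b
    · rw [indicator_of_mem hs]
      have : slabBelow u b t A ∩ {x | inner ℝ u x = s} = (fun x => x + (b - s) • u) ⁻¹' A := by
        ext x
        simp only [slabBelow, mem_inter_iff, mem_ofPred_eq, mem_preimage]
        constructor
        · rintro ⟨⟨-, h⟩, rfl⟩
          exact h
        · intro h
          have := hAb _ h
          rw [inner_add_right, inner_smul_right, real_inner_self_eq_norm_sq, hu] at this
          have hx : inner ℝ u x = s := by linarith
          rw [hx]
          exact ⟨⟨hs, h⟩, rfl⟩
      rw [this, measure_preimage_add_right]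
    · rw [indicator_of_notMem hs]
      convert measure_empty (μ := Measure.euclideanHausdorffMeasure (n - 1))
      ext x
      simp only [slabBelow, mem_inter_iff, mem_ofPred_eq, mem_empty_iff_false, iff_false]
      rintro ⟨⟨h, -⟩, rfl⟩
      exact hs h
  simp_rw [hslice]
  rw [lintegral_indicator measurableSet_Icc, setLIntegral_const, Real.volume_Icc, mul_comm]
  congr 2
  ring

/-- The cone `{s • y | 0 < s ≤ 1, y ∈ A}` over a subset `A` of the hyperplane `⟨u, x⟩ = 1`. -/
def coneOver (u : EuclideanSpace ℝ (Fin n)) (A : Set (EuclideanSpace ℝ (Fin n))) :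
    Set (EuclideanSpace ℝ (Fin n)) :=
  {x | inner ℝ u x ∈ Ioc (0 : ℝ) 1 ∧ (inner ℝ u x)⁻¹ • x ∈ A}

theorem measurableSet_coneOver {u : EuclideanSpace ℝ (Fin n)}
    {A : Set (EuclideanSpace ℝ (Fin n))} (hA : MeasurableSet A) :
    MeasurableSet (coneOver u A) :=
  (measurableSet_Ioc.preimage (f := fun x => inner ℝ u x) (by fun_prop)).inter
    (hA.preimage (f := fun x => (inner ℝ u x)⁻¹ • x) (by fun_prop))

/-- A cone of height one has volume one `n`-th of the area of its base. -/
theorem nat_mul_volume_coneOver (hn : 1 ≤ n) {u : EuclideanSpace ℝ (Fin n)} (hu : ‖u‖ = 1)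
    {A : Set (EuclideanSpace ℝ (Fin n))} (hA : MeasurableSet A) (hA1 : ∀ x ∈ A, inner ℝ u x = 1) :
    (n : ℝ≥0∞) * volume (coneOver u A) = Measure.euclideanHausdorffMeasure (n - 1) A := by
  rw [volume_eq_lintegral_slice hu (measurableSet_coneOver hA)]
  have hslice : ∀ s : ℝ, Measure.euclideanHausdorffMeasure (n - 1)
      (coneOver u A ∩ {x | inner ℝ u x = s}) =
      (Ioc 0 1).indicator (fun s => ENNReal.ofReal (s ^ (n - 1)) *
        Measure.euclideanHausdorffMeasure (n - 1) A) s := by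
    intro s
    by_cases hs : s ∈ Ioc (0 : ℝ) 1
    · have hs0 : s ≠ 0 := hs.1.ne'
      rw [indicator_of_mem hs]
      have : coneOver u A ∩ {x | inner ℝ u x = s} = s • A := by
        ext x
        simp only [coneOver, mem_inter_iff, mem_ofPred_eq, mem_smul_set_iff_inv_smul_mem₀ hs0]
        constructor
        · rintro ⟨⟨-, h⟩, rfl⟩
          exact h
        · intro h
          have := hA1 _ h
          rw [inner_smul_right] at this
          have hx : inner ℝ u x = s := by field_simp at this; exact this
          rw [hx]
          exact ⟨⟨hs, h⟩, rfl⟩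
      rw [this, Measure.euclideanHausdorffMeasure_smul₀ _ hs0, ENNReal.smul_def, smul_eq_mul,
        ENNReal.ofReal_pow hs.1.le]
      congr 1
      rw [ENNReal.coe_pow]
      congr 1
      rw [← Real.enorm_of_nonneg hs.1.le]
      rfl
    · rw [indicator_of_notMem hs]
      convert measure_empty (μ := Measure.euclideanHausdorffMeasure (n - 1))
      ext x
      simp only [coneOver, mem_inter_iff, mem_ofPred_eq, mem_empty_iff_false, iff_false]
      rintro ⟨⟨h, -⟩, rfl⟩
      exact hs h
  simp_rw [hslice]
  rw [lintegral_indicator measurableSet_Ioc, lintegral_mul_const _ (by fun_prop),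
    ← ofReal_integral_eq_lintegral_ofReal, ← intervalIntegral.integral_of_le zero_le_one,
    integral_pow, ← mul_assoc, ← ENNReal.ofReal_natCast, ← ENNReal.ofReal_mul (by positivity)]
  · have : (n : ℝ) ≠ 0 := by positivity
    have e : n - 1 + 1 = n := by omega
    have e' : ((n - 1 : ℕ) : ℝ) + 1 = n := by exact_mod_cast e
    rw [e', e, one_pow, zero_pow (by omega), sub_zero, mul_one_div_cancel this, ENNReal.ofReal_one,
      one_mul]
  · exact (intervalIntegral.intervalIntegrable_pow _).1
  · filter_upwards [ae_restrict_mem measurableSet_Ioc] with s hs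
    exact pow_nonneg hs.1.le _

end Slices

/-! ### Polytopes -/

section Polytopes

variable {n N : ℕ}

/-- The polyhedron cut out by the half-spaces `⟨u i, x⟩ ≤ b i`. -/
def polyhedron (u : Fin N → EuclideanSpace ℝ (Fin n)) (b : Fin N → ℝ) :
    Set (EuclideanSpace ℝ (Fin n)) :=
  {x | ∀ i, inner ℝ (u i) x ≤ b i}

/-- The part of the `i`-th face of a polyhedron that lies on no earlier face. These parts
partition the boundary. -/
def facetPart (u : Fin N → EuclideanSpace ℝ (Fin n)) (b : Fin N → ℝ) (i : Fin N) :
    Set (EuclideanSpace ℝ (Fin n)) :=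
  {x | x ∈ polyhedron u b ∧ inner ℝ (u i) x = b i ∧ ∀ j < i, inner ℝ (u j) x ≠ b j}

variable {u : Fin N → EuclideanSpace ℝ (Fin n)} {b : Fin N → ℝ}

theorem isClosed_polyhedron : IsClosed (polyhedron u b) := by
  simp only [polyhedron, ofPred_forall]
  exact isClosed_iInter fun i => isClosed_le (by fun_prop) (by fun_prop)

theorem convex_polyhedron : Convex ℝ (polyhedron u b) := by
  simp only [polyhedron, ofPred_forall]
  refine convex_iInter fun i => ?_
  exact convex_halfSpace_le (innerₛₗ ℝ (u i)).isLinear _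

theorem measurableSet_facetPart (i : Fin N) : MeasurableSet (facetPart u b i) := by
  have : facetPart u b i = polyhedron u b ∩ ({x | inner ℝ (u i) x = b i} ∩
      ⋂ j, ⋂ (_ : j < i), {x | inner ℝ (u j) x = b j}ᶜ) := by
    ext x
    simp only [facetPart, mem_ofPred_eq, mem_inter_iff, mem_iInter, mem_compl_iff, ne_eq]
  rw [this]
  refine isClosed_polyhedron.measurableSet.inter (MeasurableSet.inter
    (isClosed_eq (by fun_prop) (by fun_prop)).measurableSet ?_)
  exact MeasurableSet.iInter fun j => MeasurableSet.iInter fun _ =>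
    (isClosed_eq (by fun_prop) (by fun_prop)).measurableSet.compl

theorem pairwise_disjoint_facetPart : Pairwise (Function.onFun Disjoint (facetPart u b)) := by
  intro i j hij
  rw [Function.onFun, Set.disjoint_left]
  rintro x ⟨-, hi, hi'⟩ ⟨-, hj, hj'⟩
  rcases lt_or_gt_of_ne hij with h | h
  · exact hj' i h hi
  · exact hi' j h hj

theorem frontier_polyhedron (hu : ∀ i, ‖u i‖ = 1) :
    frontier (polyhedron u b) = ⋃ i, facetPart u b i := by
  ext x
  rw [isClosed_polyhedron.frontier_eq, mem_iUnion]
  constructor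
  · rintro ⟨hx, hx'⟩
    have hex : ∃ i, inner ℝ (u i) x = b i := by
      by_contra! hne
      refine hx' (mem_interior.2 ⟨{y | ∀ i, inner ℝ (u i) y < b i}, fun y hy i => (hy i).le, ?_,
        fun i => (hx i).lt_of_ne (hne i)⟩)
      simp only [ofPred_forall]
      exact isOpen_iInter_of_finite fun i => isOpen_lt (by fun_prop) (by fun_prop)
    classical
    have hne : (Finset.univ.filter fun i => inner ℝ (u i) x = b i).Nonempty := by
      obtain ⟨i, hi⟩ := hex
      exact ⟨i, by simpa using hi⟩
    refine ⟨Finset.min' _ hne, hx, by simpa using Finset.min'_mem _ hne, fun j hj hj' => ?_⟩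
    exact absurd (Finset.min'_le _ j (by simpa using hj')) (not_le.2 hj)
  · rintro ⟨i, hx, hi, -⟩
    refine ⟨hx, fun hx' => ?_⟩
    have hc : Tendsto (fun s : ℝ => x + s • u i) (𝓝[>] 0) (𝓝 x) := by
      have : Continuous fun s : ℝ => x + s • u i := by fun_prop
      simpa using (this.tendsto 0).mono_left nhdsWithin_le_nhds
    obtain ⟨s, hs, hs0⟩ := ((hc.eventually (isOpen_interior.mem_nhds hx')).and
      self_mem_nhdsWithin).exists
    have := interior_subset hs i
    rw [inner_add_right, inner_smul_right, real_inner_self_eq_norm_sq, hu, hi] at this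
    linarith

theorem sum_measure_facetPart (hu : ∀ i, ‖u i‖ = 1) :
    ∑ i, Measure.euclideanHausdorffMeasure (n - 1) (facetPart u b i) =
      Measure.euclideanHausdorffMeasure (n - 1) (frontier (polyhedron u b)) := by
  rw [frontier_polyhedron hu, measure_iUnion pairwise_disjoint_facetPart measurableSet_facetPart,
    tsum_fintype]

/-- A point at depth less than `t` in a polyhedron projects orthogonally onto its nearest face,
so the points lost by moving all faces inward by `t` are covered by slabs over the faces. -/
theorem polyhedron_subset_union_slabBelow (hu : ∀ i, ‖u i‖ = 1) {t : ℝ} :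
    polyhedron u b ⊆ polyhedron u (fun i => b i - t) ∪
      ⋃ i, slabBelow (u i) (b i) t (facetPart u b i) := by
  classical
  intro x hx
  by_cases hxt : x ∈ polyhedron u (fun i => b i - t)
  · exact Or.inl hxt
  refine Or.inr (mem_iUnion.2 ?_)
  simp only [polyhedron, mem_ofPred_eq, not_forall, not_le] at hxt
  obtain ⟨k, hk⟩ := hxt
  -- the face at least distance, and the first one in case of a tie
  obtain ⟨m, -, hm⟩ := Finset.exists_min_image Finset.univ (fun i => b i - inner ℝ (u i) x)
    ⟨k, Finset.mem_univ k⟩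
  set d := b m - inner ℝ (u m) x with hd
  have hne : (Finset.univ.filter fun i => b i - inner ℝ (u i) x = d).Nonempty :=
    ⟨m, by simp [hd]⟩
  set i := Finset.min' _ hne with hi
  have hid : b i - inner ℝ (u i) x = d := by simpa using Finset.min'_mem _ hne
  have hd0 : 0 ≤ d := sub_nonneg.2 (hx m)
  have hcs : ∀ j, inner ℝ (u j) (u i) ≤ 1 := fun j => by
    simpa [hu] using real_inner_le_norm (u j) (u i)
  refine ⟨i, ⟨?_, ?_⟩, ?_⟩
  · have := hm k (Finset.mem_univ k)
    linarith
  · linarith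
  have foot : ∀ j, inner ℝ (u j) (x + (b i - inner ℝ (u i) x) • u i) =
      inner ℝ (u j) x + d * inner ℝ (u j) (u i) := fun j => by
    rw [inner_add_right, inner_smul_right, hid]
  refine ⟨fun j => ?_, ?_, fun j hj hj' => ?_⟩
  · rw [foot]
    have := hm j (Finset.mem_univ j)
    nlinarith [hcs j]
  · rw [foot, real_inner_self_eq_norm_sq, hu]
    linarith
  · rw [foot] at hj'
    have h1 := hm j (Finset.mem_univ j)
    have h2 : b j - inner ℝ (u j) x = d := by nlinarith [hcs j]
    exact absurd (Finset.min'_le _ j (by simpa using h2)) (not_le.2 hj)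

theorem volume_polyhedron_le (hu : ∀ i, ‖u i‖ = 1) (t : ℝ) :
    volume (polyhedron u b) ≤ volume (polyhedron u (fun i => b i - t)) +
      ENNReal.ofReal t *
        Measure.euclideanHausdorffMeasure (n - 1) (frontier (polyhedron u b)) := by
  calc _ ≤ volume (polyhedron u (fun i => b i - t)) +
        ∑ i, volume (slabBelow (u i) (b i) t (facetPart u b i)) := by
        refine (measure_mono (polyhedron_subset_union_slabBelow (t := t) hu)).trans
          ((measure_union_le _ _).trans ?_)
        gcongr
        exact measure_iUnion_fintype_le _ _
    _ = _ := by
        rw [← sum_measure_facetPart hu, Finset.mul_sum]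
        congr 1
        refine Finset.sum_congr rfl fun i _ => ?_
        exact volume_slabBelow (hu i) (measurableSet_facetPart i) fun x hx => hx.2.1

/-- By the Brunn–Minkowski inequality, moving all faces of a polytope `P` inward by `t r`, where
the ball of radius `r` has at least the volume of `P`, shrinks the volume at least by the factor
`(1 - t) ^ n`. -/
theorem volume_inner_parallel_le (hu : ∀ i, ‖u i‖ = 1) {r t : ℝ} (ht0 : 0 < t)
    (ht1 : t < 1) (hV0 : volume (polyhedron u b) ≠ 0) (hV : volume (polyhedron u b) ≠ ∞)
    (hrV : volume (polyhedron u b) ≤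
      volume (Metric.closedBall (0 : EuclideanSpace ℝ (Fin n)) r)) :
    volume (polyhedron u (fun i => b i - t * r)) ≤
      ENNReal.ofReal ((1 - t) ^ n) * volume (polyhedron u b) := by
  have ht : 0 < 1 - t := by linarith
  set V := volume (polyhedron u b) with hVdef
  set Q := polyhedron u (fun i => b i - t * r) with hQ
  have hbm := brunn_minkowski ht0 ht1 (A := (1 - t)⁻¹ • Q)
    (B := Metric.closedBall (0 : EuclideanSpace ℝ (Fin n)) r) (C := polyhedron u b)
    (isClosed_polyhedron.measurableSet.const_smul₀ _) measurableSet_closedBall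
    isClosed_polyhedron.measurableSet (by
      rintro _ ⟨x, hx, rfl⟩ y hy i
      have h1 := hx i
      have h2 : inner ℝ (u i) y ≤ r := by
        have := real_inner_le_norm (u i) y
        rw [hu, one_mul] at this
        exact this.trans (by simpa using hy)
      simp only [smul_smul, mul_inv_cancel₀ ht.ne', one_smul, inner_add_right, inner_smul_right]
      nlinarith)
  replace hbm := (mul_le_mul_right (ENNReal.rpow_le_rpow hrV ht0.le) _).trans hbm
  have h1 : volume ((1 - t)⁻¹ • Q) ^ (1 - t) ≤ V ^ (1 - t) := by
    have hVt0 : V ^ t ≠ 0 := by simp [ENNReal.rpow_eq_zero_iff, hV0, hV]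
    have hVt : V ^ t ≠ ∞ := ENNReal.rpow_ne_top_of_nonneg ht0.le hV
    have : volume ((1 - t)⁻¹ • Q) ^ (1 - t) * V ^ t ≤ V ^ (1 - t) * V ^ t := by
      rw [← ENNReal.rpow_add _ _ hV0 hV]
      simpa using hbm
    exact (ENNReal.mul_le_mul_iff_left hVt0 hVt).1 this
  have h2 : volume ((1 - t)⁻¹ • Q) ≤ V := (ENNReal.rpow_le_rpow_iff ht).1 h1
  have h3 : Q = (1 - t) • ((1 - t)⁻¹ • Q) := by
    rw [smul_smul, mul_inv_cancel₀ ht.ne', one_smul]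
  rw [h3, Measure.addHaar_smul_of_nonneg _ ht.le, finrank_euclideanSpace_fin]
  gcongr

/-- Isoperimetric inequality for polytopes. -/
theorem isoperimetric_polyhedron (hu : ∀ i, ‖u i‖ = 1) {r : ℝ} (hr : 0 < r)
    (hV : volume (polyhedron u b) ≠ ∞)
    (hrV : volume (polyhedron u b) ≤
      volume (Metric.closedBall (0 : EuclideanSpace ℝ (Fin n)) r)) :
    (n : ℝ≥0∞) * volume (polyhedron u b) ≤ ENNReal.ofReal r *
      Measure.euclideanHausdorffMeasure (n - 1) (frontier (polyhedron u b)) := by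
  rcases eq_or_ne (volume (polyhedron u b)) 0 with hV0 | hV0
  · simp [hV0]
  set S := Measure.euclideanHausdorffMeasure (n - 1) (frontier (polyhedron u b)) with hS
  rcases eq_or_ne S ∞ with hS' | hS'
  · simp [hS', hr]
  set V := (volume (polyhedron u b)).toReal with hVd
  have key : ∀ t ∈ Ioo (0 : ℝ) 1, (1 - (1 - t) ^ n) / t * V ≤ r * S.toReal := by
    intro t ht
    have h1 := volume_polyhedron_le (b := b) hu (t * r)
    have h2 := volume_inner_parallel_le hu ht.1 ht.2 hV0 hV hrV
    have h3 := h1.trans (add_le_add_left h2 _)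
    have h4 := ENNReal.toReal_mono (by finiteness) h3
    have ht' : 0 ≤ 1 - t := by linarith [ht.2]
    rw [ENNReal.toReal_add (by finiteness) (by finiteness), ENNReal.toReal_mul, ENNReal.toReal_mul,
      ENNReal.toReal_ofReal (by positivity), ENNReal.toReal_ofReal (mul_pos ht.1 hr).le] at h4
    rw [div_mul_eq_mul_div, div_le_iff₀ ht.1]
    linarith
  have hlim : Tendsto (fun t : ℝ => (1 - (1 - t) ^ n) / t * V) (𝓝[>] 0) (𝓝 (n * V)) := by
    refine Tendsto.mul_const _ ?_
    have hd : HasDerivAt (fun t : ℝ => 1 - (1 - t) ^ n) n 0 := by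
      have := (((hasDerivAt_id (0 : ℝ)).const_sub 1).pow n).const_sub 1
      simpa using this
    have := hd.tendsto_slope_zero_right
    refine this.congr fun t => ?_
    simp [div_eq_inv_mul]
  have hfin : (n : ℝ) * V ≤ r * S.toReal :=
    le_of_tendsto hlim (by
      filter_upwards [Ioo_mem_nhdsGT (zero_lt_one (α := ℝ))] with t ht using key t ht)
  rw [← ENNReal.ofReal_toReal hV, ← ENNReal.ofReal_toReal hS', ← ENNReal.ofReal_natCast,
    ← ENNReal.ofReal_mul (by positivity), ← ENNReal.ofReal_mul hr.le]
  exact ENNReal.ofReal_le_ofReal hfin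

/-- A polyhedron whose faces are all at distance one from the origin has surface area at
most `n` times its volume, since it contains disjoint cones of height one over its faces. -/
theorem measure_frontier_polyhedron_one_le (hn : 1 ≤ n) (hu : ∀ i, ‖u i‖ = 1) :
    Measure.euclideanHausdorffMeasure (n - 1) (frontier (polyhedron u fun _ => 1)) ≤
      n * volume (polyhedron u fun _ => 1) := by
  rw [← sum_measure_facetPart hu]
  have hcone : ∀ i, Measure.euclideanHausdorffMeasure (n - 1) (facetPart u (fun _ => 1) i) =
      n * volume (coneOver (u i) (facetPart u (fun _ => 1) i)) := fun i =>
    (nat_mul_volume_coneOver hn (hu i) (measurableSet_facetPart i) fun x hx => hx.2.1).symm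
  simp_rw [hcone]
  have hdisj : Pairwise (Function.onFun Disjoint
      fun i => coneOver (u i) (facetPart u (fun _ => 1) i)) := by
    intro i j hij
    rw [Function.onFun, Set.disjoint_left]
    rintro x ⟨hi, hxi⟩ ⟨hj, hxj⟩
    -- both faces see `x` at the same height, so they share the projection of `x`
    have h1 := hxi.1 j
    have h2 := hxj.1 i
    rw [inner_smul_right, inv_mul_le_iff₀ hi.1, mul_one] at h1
    rw [inner_smul_right, inv_mul_le_iff₀ hj.1, mul_one] at h2
    rw [le_antisymm h1 h2] at hxj
    exact Set.disjoint_left.1 (pairwise_disjoint_facetPart hij) hxi hxj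
  rw [← Finset.mul_sum, ← tsum_fintype (L := .unconditional _), ← measure_iUnion hdisj fun i => measurableSet_coneOver (measurableSet_facetPart i)]
  gcongr
  refine iUnion_subset fun i => ?_
  rintro x ⟨hi, hx⟩ j
  have := hx.1 j
  rw [inner_smul_right, inv_mul_le_iff₀ hi.1, mul_one] at this
  exact this.trans hi.2

end Polytopes

/-! ### Surface area of convex bodies -/

section ConvexBodies

variable {n : ℕ}

theorem euclideanHausdorffMeasure_le_image_of_antilipschitz {X Y : Type*} [MetricSpace X]
    [MeasurableSpace X] [BorelSpace X] [MetricSpace Y] [MeasurableSpace Y] [BorelSpace Y]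
    {f : X → Y} (hf : AntilipschitzWith 1 f) (d : ℕ) (s : Set X) :
    Measure.euclideanHausdorffMeasure d s ≤ Measure.euclideanHausdorffMeasure d (f '' s) := by
  simp only [Measure.euclideanHausdorffMeasure_def, Measure.smul_apply]
  have := hf.le_hausdorffMeasure_image (Nat.cast_nonneg d) s
  simp only [ENNReal.coe_one, ENNReal.one_rpow, one_mul] at this
  gcongr

theorem exists_outer_normal {K : Set (EuclideanSpace ℝ (Fin n))} (hK : Convex ℝ K)
    (hK0 : (interior K).Nonempty) {x : EuclideanSpace ℝ (Fin n)} (hx : x ∉ interior K) :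
    ∃ v : EuclideanSpace ℝ (Fin n), v ≠ 0 ∧ ∀ y ∈ K, inner ℝ v y ≤ inner ℝ v x := by
  obtain ⟨f, hf0, hf⟩ := geometric_hahn_banach_of_nonempty_interior_point hK hx hK0
  refine ⟨(InnerProductSpace.toDual ℝ _).symm f, by simpa using hf0, fun y hy => ?_⟩
  simpa only [InnerProductSpace.toDual_symm_apply] using hf y hy

/-- A ray issuing from a point of a compact set passes through the boundary of that set. -/
theorem exists_mem_frontier_ray {L : Set (EuclideanSpace ℝ (Fin n))} (hL : IsCompact L)
    {x v : EuclideanSpace ℝ (Fin n)} (hx : x ∈ L) (hv : v ≠ 0) :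
    ∃ s : ℝ, 0 ≤ s ∧ x + s • v ∈ frontier L := by
  obtain ⟨R, hR⟩ := hL.isBounded.exists_norm_le
  have hv' : 0 < ‖v‖ := norm_pos_iff.2 hv
  have hc : Continuous fun s : ℝ => x + s • v := by fun_prop
  set T : Set ℝ := Ici 0 ∩ (fun s : ℝ => x + s • v) ⁻¹' L with hT
  have hTc : IsCompact T := by
    refine (isCompact_Icc (a := (0 : ℝ)) (b := (R + ‖x‖) / ‖v‖)).of_isClosed_subset
      (isClosed_Ici.inter (hL.isClosed.preimage hc)) ?_
    rintro s ⟨hs0, hs⟩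
    refine ⟨hs0, ?_⟩
    rw [le_div_iff₀ hv']
    have h1 := hR _ hs
    have h2 : ‖s • v‖ ≤ ‖x + s • v‖ + ‖x‖ := by
      calc ‖s • v‖ = ‖(x + s • v) - x‖ := by simp
        _ ≤ _ := norm_sub_le _ _
    rw [norm_smul, Real.norm_of_nonneg hs0] at h2
    linarith
  obtain ⟨s, ⟨hs0, hs⟩, hmax⟩ := hTc.exists_isGreatest ⟨0, by simp [hT, hx]⟩
  refine ⟨s, hs0, hL.isClosed.frontier_eq ▸ ⟨hs, fun hs' => ?_⟩⟩
  have hnear : ∀ᶠ s' in 𝓝[>] s, x + s' • v ∈ interior L :=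
    ((hc.tendsto s).mono_left nhdsWithin_le_nhds).eventually (isOpen_interior.mem_nhds hs')
  obtain ⟨s', h1, h2⟩ := (hnear.and self_mem_nhdsWithin).exists
  have h2' : s < s' := h2
  exact absurd (hmax ⟨le_trans hs0 h2'.le, interior_subset (s := L) h1⟩) (not_le.2 h2')

/-- Surface area is monotone on convex bodies: following outer normals of `K` until they leave
`L` is a distance-nondecreasing map from the boundary of `K` to that of `L`. -/
theorem measure_frontier_mono {K L : Set (EuclideanSpace ℝ (Fin n))} (hK : Convex ℝ K)
    (hKc : IsClosed K) (hK0 : (interior K).Nonempty) (hL : IsCompact L) (hKL : K ⊆ L) (d : ℕ) :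
    Measure.euclideanHausdorffMeasure d (frontier K) ≤
      Measure.euclideanHausdorffMeasure d (frontier L) := by
  have hex : ∀ x : frontier K, ∃ v : EuclideanSpace ℝ (Fin n),
      x.1 + v ∈ frontier L ∧ ∀ y ∈ K, inner ℝ v y ≤ inner ℝ v x.1 := by
    rintro ⟨x, hx⟩
    rw [hKc.frontier_eq] at hx
    obtain ⟨v, hv, hvK⟩ := exists_outer_normal hK hK0 hx.2
    obtain ⟨s, hs, hsL⟩ := exists_mem_frontier_ray hL (hKL hx.1) hv
    refine ⟨s • v, hsL, fun y hy => ?_⟩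
    simp only [inner_smul_left, conj_trivial]
    exact mul_le_mul_of_nonneg_left (hvK y hy) hs
  choose v hvL hvK using hex
  have hanti : AntilipschitzWith 1 fun x : frontier K => x.1 + v x := by
    refine AntilipschitzWith.of_le_mul_dist fun x y => ?_
    rw [NNReal.coe_one, one_mul, Subtype.dist_eq, dist_eq_norm, dist_eq_norm]
    have h1 := hvK x y.1 (hKc.frontier_subset y.2)
    have h2 := hvK y x.1 (hKc.frontier_subset x.2)
    have h3 := real_inner_le_norm (x.1 + v x - (y.1 + v y)) (x.1 - y.1)
    have h4 : inner ℝ (x.1 + v x - (y.1 + v y)) (x.1 - y.1) =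
        ‖x.1 - y.1‖ ^ 2 + (inner ℝ (v x) x.1 - inner ℝ (v x) y.1) +
          (inner ℝ (v y) y.1 - inner ℝ (v y) x.1) := by
      rw [← real_inner_self_eq_norm_sq]
      simp only [inner_add_left, inner_sub_left, inner_sub_right]
      ring
    rcases (norm_nonneg (x.1 - y.1)).eq_or_lt with h0 | h0
    · rw [← h0]; exact norm_nonneg _
    · refine le_of_mul_le_mul_right ?_ h0
      nlinarith
  have h := euclideanHausdorffMeasure_le_image_of_antilipschitz hanti d univ
  rw [← isometry_subtype_coe.euclideanHausdorffMeasure_image, image_univ, Subtype.range_coe] at h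
  refine h.trans (measure_mono ?_)
  rintro _ ⟨x, -, rfl⟩
  exact hvL x

theorem exists_unit_separating {L : Set (EuclideanSpace ℝ (Fin n))} (hL : Convex ℝ L)
    (hLc : IsClosed L) (hL0 : L.Nonempty) {x : EuclideanSpace ℝ (Fin n)} (hx : x ∉ L) :
    ∃ (u : EuclideanSpace ℝ (Fin n)) (b : ℝ),
      ‖u‖ = 1 ∧ (∀ y ∈ L, inner ℝ u y ≤ b) ∧ b < inner ℝ u x := by
  obtain ⟨f, c, hfc, hcx⟩ := geometric_hahn_banach_closed_point hL hLc hx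
  set v := (InnerProductSpace.toDual ℝ _).symm f with hv
  have hvf : ∀ y, inner ℝ v y = f y := fun y => InnerProductSpace.toDual_symm_apply
  have hv0 : v ≠ 0 := by
    intro h0
    obtain ⟨y, hy⟩ := hL0
    have h1 := hfc y hy
    rw [← hvf, h0, inner_zero_left] at h1 hcx
    linarith
  have hvn : 0 < ‖v‖⁻¹ := inv_pos.2 (norm_pos_iff.2 hv0)
  refine ⟨‖v‖⁻¹ • v, ‖v‖⁻¹ * c, norm_smul_inv_norm hv0, fun y hy => ?_, ?_⟩
  · rw [inner_smul_left, conj_trivial, hvf]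
    exact mul_le_mul_of_nonneg_left (hfc y hy).le hvn.le
  · rw [inner_smul_left, conj_trivial, hvf]
    exact mul_lt_mul_of_pos_left hcx hvn

/-- A convex body contains a polytope that contains a prescribed homothetic copy of the body. -/
theorem exists_inscribed_polyhedron {K : Set (EuclideanSpace ℝ (Fin n))} (hK : IsConvexBody K)
    {p : EuclideanSpace ℝ (Fin n)} (hp : p ∈ interior K) {c : ℝ} (hc0 : 0 ≤ c) (hc1 : c < 1) :
    ∃ (N : ℕ) (u : Fin N → EuclideanSpace ℝ (Fin n)) (b : Fin N → ℝ), (∀ i, ‖u i‖ = 1) ∧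
      AffineMap.homothety p c '' K ⊆ polyhedron u b ∧ polyhedron u b ⊆ K := by
  set L := AffineMap.homothety p c '' K with hL
  have hcont : Continuous (AffineMap.homothety p c : _ → EuclideanSpace ℝ (Fin n)) :=
    AffineMap.homothety_continuous _ _
  have hLK : L ⊆ interior K := by
    rintro _ ⟨x, hx, rfl⟩
    have := hK.convex.combo_interior_self_mem_interior hp hx (sub_pos.2 hc1) hc0 (by ring)
    convert this using 1
    simp only [AffineMap.homothety_apply, vsub_eq_sub, vadd_eq_add]
    module
  have hLc : IsClosed L := (hK.isCompact.image hcont).isClosed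
  have hLconv : Convex ℝ L := hK.convex.affine_image _
  have hL0 : L.Nonempty := ⟨_, p, interior_subset hp, rfl⟩
  have hsep : ∀ x : EuclideanSpace ℝ (Fin n), ∃ (u : EuclideanSpace ℝ (Fin n)) (b : ℝ),
      x ∈ frontier K → ‖u‖ = 1 ∧ (∀ y ∈ L, inner ℝ u y ≤ b) ∧ b < inner ℝ u x := by
    intro x
    by_cases hx : x ∈ frontier K
    · obtain ⟨u, b, h⟩ := exists_unit_separating hLconv hLc hL0 fun h => hx.2 (hLK h)
      exact ⟨u, b, fun _ => h⟩
    · exact ⟨0, 0, fun h => absurd h hx⟩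
  choose u b hub using hsep
  obtain ⟨t, htK, htc⟩ := (hK.isCompact.of_isClosed_subset isClosed_frontier
    hK.isCompact.isClosed.frontier_subset).elim_nhds_subcover
    (fun x => {y | b x < inner ℝ (u x) y}) fun x hx =>
      (isOpen_lt (by fun_prop) (by fun_prop)).mem_nhds (hub x hx).2.2
  have hmem : ∀ i : Fin t.card, (t.equivFin.symm i : EuclideanSpace ℝ (Fin n)) ∈ frontier K :=
    fun i => htK _ (t.equivFin.symm i).2
  refine ⟨t.card, fun i => u (t.equivFin.symm i), fun i => b (t.equivFin.symm i),
    fun i => (hub _ (hmem i)).1, fun y hy i => (hub _ (hmem i)).2.1 y hy, ?_⟩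
  refine Subset.trans ?_ (interior_subset (s := K))
  refine IsPreconnected.subset_left_of_subset_union isOpen_interior
    hK.isCompact.isClosed.isOpen_compl
    (disjoint_compl_right.mono_left interior_subset) ?_ ?_ convex_polyhedron.isPreconnected
  · intro y hy
    by_contra hyn
    simp only [mem_union, mem_compl_iff, not_or, not_not] at hyn
    have hyf : y ∈ frontier K := hK.isCompact.isClosed.frontier_eq ▸ ⟨hyn.2, hyn.1⟩
    obtain ⟨x, hx, hxy⟩ := mem_iUnion₂.1 (htc hyf)
    have := hy (t.equivFin ⟨x, hx⟩)
    simp only [Equiv.symm_apply_apply] at this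
    exact absurd this (not_le.2 hxy)
  · obtain ⟨y, hy⟩ := hL0
    exact ⟨y, fun i => (hub _ (hmem i)).2.1 y hy, hLK hy⟩

/-- Isoperimetric inequality: among the convex bodies of given volume, the ball has the least
surface area. -/
theorem isoperimetric {K : Set (EuclideanSpace ℝ (Fin n))} (hK : IsConvexBody K) {r : ℝ}
    (hr : 0 < r)
    (hrV : volume K ≤ volume (Metric.closedBall (0 : EuclideanSpace ℝ (Fin n)) r)) :
    (n : ℝ≥0∞) * volume K ≤ ENNReal.ofReal r *
      Measure.euclideanHausdorffMeasure (n - 1) (frontier K) := by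
  obtain ⟨p, hp⟩ := hK.nonempty_interior
  have hKfin : volume K ≠ ∞ := hK.isCompact.measure_lt_top.ne
  have key : ∀ c ∈ Ioo (0 : ℝ) 1, (n : ℝ≥0∞) * (ENNReal.ofReal (c ^ n) * volume K) ≤
      ENNReal.ofReal r * Measure.euclideanHausdorffMeasure (n - 1) (frontier K) := by
    intro c hc
    obtain ⟨N, u, b, hu, hLP, hPK⟩ := exists_inscribed_polyhedron hK hp hc.1.le hc.2
    have hvol : ENNReal.ofReal (c ^ n) * volume K ≤ volume (polyhedron u b) := by
      refine le_of_eq_of_le ?_ (measure_mono hLP)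
      rw [Measure.addHaar_image_homothety, finrank_euclideanSpace_fin,
        abs_of_pos (pow_pos hc.1 n)]
    have hint : (interior (polyhedron u b)).Nonempty := by
      refine Set.Nonempty.mono (interior_mono hLP) ?_
      have := (AffineMap.homothety_isOpenMap p c hc.1.ne').image_interior_subset K
      exact Set.Nonempty.mono this ⟨_, p, hp, rfl⟩
    calc _ ≤ (n : ℝ≥0∞) * volume (polyhedron u b) := by gcongr
      _ ≤ ENNReal.ofReal r *
          Measure.euclideanHausdorffMeasure (n - 1) (frontier (polyhedron u b)) :=
        isoperimetric_polyhedron hu hr ((measure_mono hPK).trans_lt hKfin.lt_top).ne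
          ((measure_mono hPK).trans hrV)
      _ ≤ _ := by
        exact mul_le_mul_right (measure_frontier_mono convex_polyhedron isClosed_polyhedron hint
          hK.isCompact hPK _) _
  have hlim : Tendsto (fun c : ℝ => (n : ℝ≥0∞) * (ENNReal.ofReal (c ^ n) * volume K)) (𝓝[<] 1)
      (𝓝 ((n : ℝ≥0∞) * volume K)) := by
    have h1 : Tendsto (fun c : ℝ => ENNReal.ofReal (c ^ n)) (𝓝[<] 1) (𝓝 1) := by
      have : Continuous fun c : ℝ => ENNReal.ofReal (c ^ n) :=
        ENNReal.continuous_ofReal.comp (by fun_prop)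
      simpa using (this.tendsto 1).mono_left nhdsWithin_le_nhds
    simpa using ENNReal.Tendsto.const_mul (ENNReal.Tendsto.mul_const h1 (Or.inr hKfin))
      (Or.inr (ENNReal.natCast_ne_top n))
  exact le_of_tendsto hlim (by
    filter_upwards [Ioo_mem_nhdsLT (zero_lt_one (α := ℝ))] with c hc using key c hc)

/-- The surface area of the unit ball is at most `n` times its volume: compare the ball with
polytopes circumscribed about it. -/
theorem measure_frontier_closedBall_one_le (hn : 1 ≤ n) :
    Measure.euclideanHausdorffMeasure (n - 1)
      (frontier (Metric.closedBall (0 : EuclideanSpace ℝ (Fin n)) 1)) ≤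
        n * volume (Metric.closedBall (0 : EuclideanSpace ℝ (Fin n)) 1) := by
  set B := Metric.closedBall (0 : EuclideanSpace ℝ (Fin n)) 1 with hB
  have hBfin : volume B ≠ ∞ := measure_closedBall_lt_top.ne
  have key : ∀ c ∈ Ioo (0 : ℝ) 1,
      Measure.euclideanHausdorffMeasure (n - 1) (frontier B) ≤
        n * (ENNReal.ofReal (c⁻¹ ^ n) * volume B) := by
    intro c hc
    obtain ⟨t, htS, htc⟩ := (isCompact_sphere (0 : EuclideanSpace ℝ (Fin n)) 1).elim_nhds_subcover
      (fun x => {y | c < inner ℝ x y}) fun x hx =>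
        (isOpen_lt (by fun_prop) (by fun_prop)).mem_nhds (by
          have : ‖x‖ = 1 := by simpa using hx
          simp [this, hc.2])
    set u : Fin t.card → EuclideanSpace ℝ (Fin n) := fun i => t.equivFin.symm i with hudef
    have hu : ∀ i, ‖u i‖ = 1 := fun i => by
      simpa using htS _ (t.equivFin.symm i).2
    have hBP : B ⊆ polyhedron u fun _ => 1 := by
      intro x hx i
      have := real_inner_le_norm (u i) x
      rw [hu, one_mul] at this
      exact this.trans (by simpa [hB] using hx)
    have hPB : (polyhedron u fun _ => 1) ⊆ Metric.closedBall 0 c⁻¹ := by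
      intro x hx
      rcases eq_or_ne x 0 with rfl | hx0
      · simpa using hc.1.le
      obtain ⟨y, hy, hxy⟩ := mem_iUnion₂.1 (htc (show ‖x‖⁻¹ • x ∈ Metric.sphere 0 1 by
        rw [mem_sphere_zero_iff_norm]; exact norm_smul_inv_norm hx0))
      have h1 := hx (t.equivFin ⟨y, hy⟩)
      simp only [hudef, Equiv.symm_apply_apply] at h1
      have h2 : c < ‖x‖⁻¹ * inner ℝ y x := by
        have : c < inner ℝ y (‖x‖⁻¹ • x) := hxy
        rwa [inner_smul_right] at this
      have hxp : 0 < ‖x‖ := norm_pos_iff.2 hx0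
      rw [inv_mul_eq_div, lt_div_iff₀ hxp] at h2
      rw [mem_closedBall_zero_iff, ← one_div, le_div_iff₀ hc.1]
      linarith
    have hPc : IsCompact (polyhedron u fun _ => (1 : ℝ)) :=
      (isCompact_closedBall 0 c⁻¹).of_isClosed_subset isClosed_polyhedron hPB
    calc _ ≤ Measure.euclideanHausdorffMeasure (n - 1) (frontier (polyhedron u fun _ => 1)) := by
          refine measure_frontier_mono (convex_closedBall _ _) Metric.isClosed_closedBall ?_ hPc
            hBP _
          rw [interior_closedBall _ one_ne_zero]
          exact ⟨0, by simp⟩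
      _ ≤ n * volume (polyhedron u fun _ => 1) := measure_frontier_polyhedron_one_le hn hu
      _ ≤ n * volume (Metric.closedBall (0 : EuclideanSpace ℝ (Fin n)) c⁻¹) := by gcongr
      _ = _ := by
          rw [Measure.addHaar_closedBall' _ _ (inv_nonneg.2 hc.1.le), finrank_euclideanSpace_fin]
  have hlim : Tendsto (fun c : ℝ => (n : ℝ≥0∞) * (ENNReal.ofReal (c⁻¹ ^ n) * volume B)) (𝓝[<] 1)
      (𝓝 ((n : ℝ≥0∞) * volume B)) := by
    have h1 : Tendsto (fun c : ℝ => ENNReal.ofReal (c⁻¹ ^ n)) (𝓝[<] 1) (𝓝 1) := by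
      have : ContinuousAt (fun c : ℝ => ENNReal.ofReal (c⁻¹ ^ n)) 1 := by
        refine ENNReal.continuous_ofReal.continuousAt.comp ?_
        exact (continuousAt_inv₀ one_ne_zero).pow n
      simpa using this.tendsto.mono_left nhdsWithin_le_nhds
    simpa using ENNReal.Tendsto.const_mul (ENNReal.Tendsto.mul_const h1 (Or.inr hBfin))
      (Or.inr (ENNReal.natCast_ne_top n))
  exact ge_of_tendsto hlim (by
    filter_upwards [Ioo_mem_nhdsLT (zero_lt_one (α := ℝ))] with c hc using key c hc)

/-- Finiteness of the surface area, so that `surfaceArea` is not a junk value. -/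
theorem measure_frontier_lt_top (hn : 1 ≤ n) {K : Set (EuclideanSpace ℝ (Fin n))}
    (hK : IsConvexBody K) :
    Measure.euclideanHausdorffMeasure (n - 1) (frontier K) < ∞ := by
  obtain ⟨R, hR0, hR⟩ := hK.isCompact.isBounded.exists_pos_norm_le
  have hsub : K ⊆ Metric.closedBall 0 R := fun x hx => by simpa using hR x hx
  refine (measure_frontier_mono hK.convex hK.isCompact.isClosed hK.nonempty_interior
    (isCompact_closedBall 0 R) hsub _).trans_lt ?_
  have hscale : frontier (Metric.closedBall (0 : EuclideanSpace ℝ (Fin n)) R) =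
      R • frontier (Metric.closedBall (0 : EuclideanSpace ℝ (Fin n)) 1) := by
    rw [frontier_closedBall _ hR0.ne', frontier_closedBall _ one_ne_zero,
      smul_sphere' hR0.ne', smul_zero, Real.norm_of_nonneg hR0.le, mul_one]
  rw [hscale, Measure.euclideanHausdorffMeasure_smul₀ _ hR0.ne', ENNReal.smul_def, smul_eq_mul]
  refine ENNReal.mul_lt_top ENNReal.coe_lt_top
    ((measure_frontier_closedBall_one_le hn).trans_lt ?_)
  exact ENNReal.mul_lt_top (ENNReal.natCast_lt_top n) measure_closedBall_lt_top

end ConvexBodies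

/-! ### Urysohn's inequality -/

section MeanWidth

variable {n : ℕ}

theorem inner_le_supportFunction {K : Set (EuclideanSpace ℝ (Fin n))} (hK : IsCompact K)
    {x : EuclideanSpace ℝ (Fin n)} (hx : x ∈ K) (y : EuclideanSpace ℝ (Fin n)) :
    inner ℝ x y ≤ supportFunction K y :=
  le_csSup (hK.bddAbove_image (by fun_prop)) ⟨x, hx, rfl⟩

theorem continuous_supportFunction {K : Set (EuclideanSpace ℝ (Fin n))} (hK : IsCompact K) :
    Continuous (supportFunction K) :=
  hK.continuous_sSup (f := fun y x => inner ℝ x y) (by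
    simp only [Function.HasUncurry.uncurry, id]
    fun_prop)

theorem integrable_sphere_of_continuous
    {f : Metric.sphere (0 : EuclideanSpace ℝ (Fin n)) 1 → ℝ} (hf : Continuous f) :
    Integrable f (volume : Measure (EuclideanSpace ℝ (Fin n))).toSphere := by
  rw [← integrableOn_univ]
  exact hf.continuousOn.integrableOn_compact isCompact_univ

/-- The open star-shaped set with radial function `ρ`, with the origin removed. -/
def puncturedStar (ρ : Metric.sphere (0 : EuclideanSpace ℝ (Fin n)) 1 → ℝ) :
    Set (EuclideanSpace ℝ (Fin n)) :=
  Subtype.val '' (homeomorphUnitSphereProd (EuclideanSpace ℝ (Fin n)) ⁻¹' {p | p.2.1 < ρ p.1})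

theorem measurableSet_puncturedStar
    {ρ : Metric.sphere (0 : EuclideanSpace ℝ (Fin n)) 1 → ℝ} (hρ : Continuous ρ) :
    MeasurableSet (puncturedStar ρ) := by
  refine (MeasurableEmbedding.subtype_coe
    (measurableSet_singleton _).compl).measurableSet_image.2 ?_
  refine (IsOpen.preimage (Homeomorph.continuous _) ?_).measurableSet
  exact isOpen_lt (by fun_prop) (by fun_prop)

/-- The volume of a star-shaped set in polar coordinates. -/
theorem nat_mul_volume_puncturedStar (hn : 1 ≤ n)
    {ρ : Metric.sphere (0 : EuclideanSpace ℝ (Fin n)) 1 → ℝ} (hρ : Continuous ρ)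
    (hρ0 : ∀ θ, 0 < ρ θ) :
    (n : ℝ≥0∞) * volume (puncturedStar ρ) = ∫⁻ θ, ENNReal.ofReal (ρ θ ^ n)
      ∂(volume : Measure (EuclideanSpace ℝ (Fin n))).toSphere := by
  have hm : MeasurableSet {p : Metric.sphere (0 : EuclideanSpace ℝ (Fin n)) 1 × Ioi (0 : ℝ) |
      p.2.1 < ρ p.1} := (isOpen_lt (by fun_prop) (by fun_prop)).measurableSet
  have hmp :=
    (volume : Measure (EuclideanSpace ℝ (Fin n))).measurePreserving_homeomorphUnitSphereProd
  rw [puncturedStar, ← comap_subtype_coe_apply (measurableSet_singleton _).compl,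
    hmp.measure_preimage hm.nullMeasurableSet, Measure.prod_apply hm,
    ← lintegral_const_mul' _ _ (ENNReal.natCast_ne_top n)]
  refine lintegral_congr fun θ => ?_
  have : Prod.mk θ ⁻¹' {p : Metric.sphere (0 : EuclideanSpace ℝ (Fin n)) 1 × Ioi (0 : ℝ) |
      p.2.1 < ρ p.1} = Iio ⟨ρ θ, hρ0 θ⟩ := by
    ext s
    simp [← Subtype.coe_lt_coe]
  have e : n - 1 + 1 = n := by omega
  have e' : ((n - 1 : ℕ) : ℝ) + 1 = n := by exact_mod_cast e
  rw [this, Measure.volumeIoiPow_apply_Iio, finrank_euclideanSpace_fin, e', e,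
    ← ENNReal.ofReal_natCast, ← ENNReal.ofReal_mul (by positivity), mul_div_cancel₀]
  positivity

/-- In the radial direction `θ`, the Minkowski combination of the unit ball and `r⁻¹ • K` reaches
at most as far as the same combination of the support functions. -/
theorem combo_mem_puncturedStar {K : Set (EuclideanSpace ℝ (Fin n))} (hK : IsCompact K)
    {r t : ℝ} (hr : 0 < r) (ht0 : 0 < t) (ht1 : t < 1) {x y : EuclideanSpace ℝ (Fin n)}
    (hx : x ∈ Metric.ball (0 : EuclideanSpace ℝ (Fin n)) 1) (hy : y ∈ r⁻¹ • K) :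
    (1 - t) • x + t • y ∈
      insert 0 (puncturedStar fun θ => 1 + t * (supportFunction K θ / r - 1)) := by
  obtain ⟨k, hk, rfl⟩ := hy
  set z := (1 - t) • x + t • (r⁻¹ • k) with hz
  rcases eq_or_ne z 0 with hz0 | hz0
  · exact Or.inl hz0
  refine Or.inr ⟨⟨z, hz0⟩, ?_, rfl⟩
  simp only [mem_preimage, mem_ofPred_eq, homeomorphUnitSphereProd_apply_snd_coe,
    homeomorphUnitSphereProd_apply_fst_coe]
  set θ := ‖z‖⁻¹ • z with hθ
  have hθ1 : ‖θ‖ = 1 := norm_smul_inv_norm hz0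
  have hzθ : inner ℝ z θ = ‖z‖ := by
    rw [hθ, inner_smul_right, real_inner_self_eq_norm_sq]
    have : ‖z‖ ≠ 0 := norm_ne_zero_iff.2 hz0
    field_simp
  have h1 : inner ℝ x θ < 1 := by
    have := real_inner_le_norm x θ
    rw [hθ1, mul_one] at this
    exact this.trans_lt (by simpa using hx)
  have h2 := inner_le_supportFunction hK hk θ
  have h3 : inner ℝ z θ = (1 - t) * inner ℝ x θ + t * (inner ℝ k θ / r) := by
    rw [hz, inner_add_left, inner_smul_left, inner_smul_left, inner_smul_left]
    simp only [conj_trivial]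
    ring
  have h4 : inner ℝ k θ / r ≤ supportFunction K θ / r := by gcongr
  rw [← hzθ, h3]
  nlinarith

/-- Urysohn's inequality: among the convex bodies of given volume, the ball has the least mean
width. -/
theorem urysohn (hn : 1 ≤ n) {K : Set (EuclideanSpace ℝ (Fin n))} (hK : IsCompact K)
    {r : ℝ} (hr : 0 < r)
    (hrV : volume (Metric.closedBall (0 : EuclideanSpace ℝ (Fin n)) r) ≤ volume K) :
    r ≤ meanWidth K := by
  set σ := (volume : Measure (EuclideanSpace ℝ (Fin n))).toSphere with hσ
  have hn' : (0 : ℝ) < n := by exact_mod_cast hn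
  have : Nonempty (Fin n) := ⟨⟨0, hn⟩⟩
  set z : Metric.sphere (0 : EuclideanSpace ℝ (Fin n)) 1 → ℝ :=
    fun θ => supportFunction K θ / r - 1 with hz
  have hzc : Continuous z :=
    (((continuous_supportFunction hK).comp continuous_subtype_val).div_const r).sub
      continuous_const
  obtain ⟨M, hM0, hM⟩ : ∃ M : ℝ, 0 < M ∧ ∀ θ, |z θ| ≤ M := by
    obtain ⟨M, hM0, hM⟩ := (isCompact_range hzc).isBounded.exists_pos_norm_le
    exact ⟨M, hM0, fun θ => hM _ ⟨θ, rfl⟩⟩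
  have radial_pos : ∀ t : ℝ, 0 < t → n * t * M < 1 → ∀ θ, 0 < 1 + t * z θ := by
    intro t ht0 htM θ
    have h1 := neg_le_of_abs_le (hM θ)
    have h2 : (1 : ℝ) ≤ n := by exact_mod_cast hn
    have h3 : t * M ≤ n * t * M := by
      rw [mul_assoc]; exact le_mul_of_one_le_left (by positivity) h2
    nlinarith
  -- the volume of the combination `(1 - t) B + t r⁻¹ K`, bounded below by Brunn–Minkowski
  have key : ∀ t : ℝ, 0 < t → t < 1 → n * t * M < 1 →
      σ.real univ ≤ ∫ θ, (1 + t * z θ) ^ n ∂σ := by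
    intro t ht0 ht1 htM
    have hpos := radial_pos t ht0 htM
    have hρc : Continuous fun θ => 1 + t * z θ := by fun_prop
    have hball0 : volume (Metric.ball (0 : EuclideanSpace ℝ (Fin n)) 1) ≠ 0 :=
      (Metric.measure_ball_pos _ _ one_pos).ne'
    have hball : volume (Metric.ball (0 : EuclideanSpace ℝ (Fin n)) 1) ≠ ∞ :=
      measure_ball_lt_top.ne
    have hvolK : volume (Metric.ball (0 : EuclideanSpace ℝ (Fin n)) 1) ≤ volume (r⁻¹ • K) := by
      have hr' : 0 < r⁻¹ := inv_pos.2 hr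
      calc _ ≤ volume (Metric.closedBall (0 : EuclideanSpace ℝ (Fin n)) 1) :=
            measure_mono Metric.ball_subset_closedBall
        _ = volume (r⁻¹ • Metric.closedBall (0 : EuclideanSpace ℝ (Fin n)) r) := by
            rw [smul_closedBall' hr'.ne', smul_zero, Real.norm_of_nonneg hr'.le,
              inv_mul_cancel₀ hr.ne']
        _ ≤ _ := by
            rw [Measure.addHaar_smul, Measure.addHaar_smul]
            gcongr
    have hbm := brunn_minkowski ht0 ht1 (A := Metric.ball (0 : EuclideanSpace ℝ (Fin n)) 1)
      (B := r⁻¹ • K) (C := insert 0 (puncturedStar fun θ => 1 + t * z θ))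
      measurableSet_ball (hK.measurableSet.const_smul₀ _)
      ((measurableSet_puncturedStar hρc).insert 0)
      fun x hx y hy => combo_mem_puncturedStar hK hr ht0 ht1 hx hy
    have h1 : volume (Metric.ball (0 : EuclideanSpace ℝ (Fin n)) 1) ≤
        volume (puncturedStar fun θ => 1 + t * z θ) := by
      calc _ = volume (Metric.ball (0 : EuclideanSpace ℝ (Fin n)) 1) ^ (1 - t) *
            volume (Metric.ball (0 : EuclideanSpace ℝ (Fin n)) 1) ^ t := by
            rw [← ENNReal.rpow_add _ _ hball0 hball]; simp
        _ ≤ volume (Metric.ball (0 : EuclideanSpace ℝ (Fin n)) 1) ^ (1 - t) *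
            volume (r⁻¹ • K) ^ t := by gcongr
        _ ≤ _ := hbm
        _ ≤ volume {(0 : EuclideanSpace ℝ (Fin n))} + volume (puncturedStar fun θ => 1 + t * z θ) :=
            measure_union_le _ _
        _ = _ := by simp
    have h2 : σ univ ≤ ∫⁻ θ, ENNReal.ofReal ((1 + t * z θ) ^ n) ∂σ := by
      rw [← nat_mul_volume_puncturedStar hn hρc hpos, hσ, Measure.toSphere_apply_univ,
        finrank_euclideanSpace_fin]
      gcongr
    rw [← ofReal_integral_eq_lintegral_ofReal (integrable_sphere_of_continuous (by fun_prop))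
      (Eventually.of_forall fun θ => pow_nonneg (hpos θ).le n)] at h2
    have h3 := ENNReal.toReal_mono ENNReal.ofReal_ne_top h2
    rwa [ENNReal.toReal_ofReal (integral_nonneg fun θ => pow_nonneg (hpos θ).le n)] at h3
  -- the integrand is at most `exp (n t z)`, hence at most `1 + n t z + (n t M) ^ 2`
  have key2 : ∀ t : ℝ, 0 < t → t < 1 → n * t * M < 1 →
      0 ≤ (∫ θ, z θ ∂σ) + n * t * M ^ 2 * σ.real univ := by
    intro t ht0 ht1 htM
    have hbound : ∀ θ, (1 + t * z θ) ^ n ≤ 1 + (n * t) * z θ + (n * t * M) ^ 2 := by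
      intro θ
      have habs : |n * t * z θ| ≤ n * t * M := by
        rw [abs_mul, abs_of_pos (by positivity)]
        exact mul_le_mul_of_nonneg_left (hM θ) (by positivity)
      have h0 : 0 ≤ 1 + t * z θ := (radial_pos t ht0 htM θ).le
      have h1 : (1 + t * z θ) ^ n ≤ Real.exp (n * t * z θ) := by
        have : 1 + t * z θ ≤ Real.exp (t * z θ) := by linarith [Real.add_one_le_exp (t * z θ)]
        calc _ ≤ Real.exp (t * z θ) ^ n := by gcongr
          _ = _ := by rw [← Real.exp_nat_mul, mul_assoc]
      have h2 := (abs_le.1 (Real.abs_exp_sub_one_sub_id_le (habs.trans htM.le))).2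
      have h3 : (n * t * z θ) ^ 2 ≤ (n * t * M) ^ 2 := by
        rw [← sq_abs (n * t * z θ)]
        gcongr
      linarith
    have hint := (key t ht0 ht1 htM).trans (integral_mono
      (integrable_sphere_of_continuous (by fun_prop))
      (integrable_sphere_of_continuous (f := fun θ => 1 + (n * t) * z θ + (n * t * M) ^ 2)
        (by fun_prop)) hbound)
    rw [integral_add (integrable_sphere_of_continuous (by fun_prop)) (integrable_const _),
      integral_add (integrable_const _) (integrable_sphere_of_continuous (by fun_prop)),
      integral_const_mul, integral_const, integral_const, smul_eq_mul, smul_eq_mul] at hint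
    have h4 : 0 ≤ (n * t) * ((∫ θ, z θ ∂σ) + n * t * M ^ 2 * σ.real univ) := by
      nlinarith
    exact nonneg_of_mul_nonneg_right h4 (by positivity)
  have hz0 : 0 ≤ ∫ θ, z θ ∂σ := by
    have hlim : Tendsto (fun t : ℝ => (∫ θ, z θ ∂σ) + n * t * M ^ 2 * σ.real univ) (𝓝[>] 0)
        (𝓝 (∫ θ, z θ ∂σ)) := by
      have : Continuous fun t : ℝ => (∫ θ, z θ ∂σ) + n * t * M ^ 2 * σ.real univ := by fun_prop
      simpa using (this.tendsto 0).mono_left nhdsWithin_le_nhds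
    refine ge_of_tendsto hlim ?_
    have hsmall : ∀ᶠ t : ℝ in 𝓝[>] 0, n * t * M < 1 := by
      have : Continuous fun t : ℝ => n * t * M := by fun_prop
      refine ((this.tendsto 0).mono_left nhdsWithin_le_nhds).eventually (gt_mem_nhds ?_)
      simp
    filter_upwards [hsmall, Ioo_mem_nhdsGT (zero_lt_one (α := ℝ))] with t h1 h2
    exact key2 t h2.1 h2.2 h1
  have hσpos : 0 < σ.real univ := by
    rw [hσ, Measure.toSphere_real_apply_univ, finrank_euclideanSpace_fin]
    exact mul_pos hn' (ENNReal.toReal_pos (Metric.measure_ball_pos _ _ one_pos).ne'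
      measure_ball_lt_top.ne)
  have hh : Integrable (fun θ : Metric.sphere (0 : EuclideanSpace ℝ (Fin n)) 1 =>
      supportFunction K θ) σ :=
    integrable_sphere_of_continuous ((continuous_supportFunction hK).comp continuous_subtype_val)
  rw [hz, integral_sub (hh.div_const r) (integrable_const _), integral_div, integral_const,
    smul_eq_mul, mul_one, sub_nonneg, le_div_iff₀ hr] at hz0
  rw [meanWidth, average_eq, smul_eq_mul, inv_mul_eq_div, le_div_iff₀ hσpos]
  linarith

end MeanWidth

/-! ### The lower bound for `q` and the ball -/

section QLowerBound

variable {n : ℕ}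

theorem exists_pos_volume_closedBall_eq (hn : 1 ≤ n) {V : ℝ≥0∞} (hV0 : V ≠ 0) (hV : V ≠ ∞) :
    ∃ r : ℝ, 0 < r ∧ volume (Metric.closedBall (0 : EuclideanSpace ℝ (Fin n)) r) = V := by
  set κ := volume (Metric.closedBall (0 : EuclideanSpace ℝ (Fin n)) 1) with hκ
  have hκ0 : κ ≠ 0 := (Metric.measure_closedBall_pos _ _ one_pos).ne'
  have hκt : κ ≠ ∞ := measure_closedBall_lt_top.ne
  have hpos : 0 < (V / κ).toReal :=
    ENNReal.toReal_pos (ENNReal.div_ne_zero.2 ⟨hV0, hκt⟩) (ENNReal.div_ne_top hV hκ0)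
  refine ⟨(V / κ).toReal ^ ((n : ℝ)⁻¹), by positivity, ?_⟩
  rw [Measure.addHaar_closedBall' _ _ (by positivity), finrank_euclideanSpace_fin,
    Real.rpow_inv_natCast_pow hpos.le (by omega),
    ENNReal.ofReal_toReal (ENNReal.div_ne_top hV hκ0), ENNReal.div_mul_cancel hκ0 hκt]

theorem nat_mul_volume_le_mul_surfaceArea (hn : 1 ≤ n) {K : Set (EuclideanSpace ℝ (Fin n))}
    (hK : IsConvexBody K) {r : ℝ} (hr : 0 < r)
    (hrV : volume K ≤ volume (Metric.closedBall (0 : EuclideanSpace ℝ (Fin n)) r)) :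
    n * (volume : Measure (EuclideanSpace ℝ (Fin n))).real K ≤ r * surfaceArea K := by
  have h := ENNReal.toReal_mono (ENNReal.mul_ne_top ENNReal.ofReal_ne_top
    (measure_frontier_lt_top hn hK).ne) (isoperimetric hK hr hrV)
  rwa [ENNReal.toReal_mul, ENNReal.toReal_mul, ENNReal.toReal_natCast,
    ENNReal.toReal_ofReal hr.le] at h

theorem IsConvexBody.volume_ne_zero {K : Set (EuclideanSpace ℝ (Fin n))} (hK : IsConvexBody K) :
    volume K ≠ 0 :=
  (Measure.measure_pos_of_nonempty_interior _ hK.nonempty_interior).ne'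

theorem IsConvexBody.volume_real_pos {K : Set (EuclideanSpace ℝ (Fin n))} (hK : IsConvexBody K) :
    0 < (volume : Measure (EuclideanSpace ℝ (Fin n))).real K :=
  ENNReal.toReal_pos hK.volume_ne_zero hK.isCompact.measure_lt_top.ne

/-- With `r` the radius of the ball of the same volume as `K`, the mean width is at least `r` and
the surface area at least `n |K| / r`. -/
theorem le_q (hn : 1 ≤ n) {K : Set (EuclideanSpace ℝ (Fin n))} (hK : IsConvexBody K) :
    (n : ℝ) ≤ q K := by
  obtain ⟨r, hr, hrV⟩ :=
    exists_pos_volume_closedBall_eq hn hK.volume_ne_zero hK.isCompact.measure_lt_top.ne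
  rw [q, le_div_iff₀ hK.volume_real_pos]
  calc _ ≤ r * surfaceArea K := nat_mul_volume_le_mul_surfaceArea hn hK hr hrV.ge
    _ ≤ _ := mul_le_mul_of_nonneg_right (urysohn hn hK.isCompact hr hrV.le) ENNReal.toReal_nonneg

theorem isConvexBody_closedBall {r : ℝ} (hr : 0 < r) :
    IsConvexBody (Metric.closedBall (0 : EuclideanSpace ℝ (Fin n)) r) where
  convex := convex_closedBall _ _
  isCompact := isCompact_closedBall _ _
  nonempty_interior := by
    rw [interior_closedBall _ hr.ne']
    exact ⟨0, by simpa using hr⟩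

theorem meanWidth_closedBall_one (hn : 1 ≤ n) :
    meanWidth (Metric.closedBall (0 : EuclideanSpace ℝ (Fin n)) 1) = 1 := by
  have : Nonempty (Fin n) := ⟨⟨0, hn⟩⟩
  have h : ∀ ξ : Metric.sphere (0 : EuclideanSpace ℝ (Fin n)) 1,
      supportFunction (Metric.closedBall 0 1) (ξ : EuclideanSpace ℝ (Fin n)) = 1 := by
    intro ξ
    have hξ : ‖(ξ : EuclideanSpace ℝ (Fin n))‖ = 1 := by simp
    refine IsGreatest.csSup_eq ⟨⟨ξ, by simp, ?_⟩, ?_⟩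
    · simp
    · rintro _ ⟨x, hx, rfl⟩
      have := real_inner_le_norm x (ξ : EuclideanSpace ℝ (Fin n))
      rw [hξ, mul_one] at this
      exact this.trans (by simpa using hx)
  have : NeZero (volume : Measure (EuclideanSpace ℝ (Fin n))).toSphere :=
    ⟨Measure.toSphere_ne_zero _⟩
  simp only [meanWidth, h]
  exact average_const _ _

theorem q_closedBall_one (hn : 1 ≤ n) :
    q (Metric.closedBall (0 : EuclideanSpace ℝ (Fin n)) 1) = n := by
  have hB := isConvexBody_closedBall (n := n) one_pos
  refine le_antisymm ?_ (le_q hn hB)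
  rw [q, div_le_iff₀ hB.volume_real_pos, meanWidth_closedBall_one hn, one_mul]
  have h := ENNReal.toReal_mono (ENNReal.mul_ne_top (ENNReal.natCast_ne_top n)
    hB.isCompact.measure_lt_top.ne) (measure_frontier_closedBall_one_le hn)
  rwa [ENNReal.toReal_mul, ENNReal.toReal_natCast] at h

end QLowerBound

/-! ### Elongated ellipsoids -/

section Ellipsoids

variable {n : ℕ} {a : Fin n → ℝ}

theorem ellipsoid_subset_box (ha : ∀ i, 0 < a i) :
    ellipsoid a ⊆ (WithLp.ofLp : EuclideanSpace ℝ (Fin n) → Fin n → ℝ) ⁻¹' Icc (-a) a := by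
  intro x hx
  have h : ∀ i, |x i| ≤ a i := fun i => by
    have h1 : (x i / a i) ^ 2 ≤ 1 :=
      (Finset.single_le_sum (f := fun i => (x i / a i) ^ 2) (fun j _ => sq_nonneg _)
        (Finset.mem_univ i)).trans hx
    rw [sq_le_one_iff_abs_le_one, abs_div, abs_of_pos (ha i), div_le_one (ha i)] at h1
    exact h1
  exact ⟨fun i => (abs_le.1 (h i)).1, fun i => (abs_le.1 (h i)).2⟩

theorem isConvexBody_ellipsoid (ha : ∀ i, 0 < a i) : IsConvexBody (ellipsoid a) where
  convex := by
    intro x hx y hy s t hs ht hst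
    have h : ∀ i, ((s • x + t • y) i / a i) ^ 2 ≤ s * (x i / a i) ^ 2 + t * (y i / a i) ^ 2 := by
      intro i
      have e : (s • x + t • y) i / a i = s * (x i / a i) + t * (y i / a i) := by
        simp only [PiLp.add_apply, PiLp.smul_apply, smul_eq_mul]
        ring
      rw [e]
      obtain rfl : t = 1 - s := by linarith
      nlinarith [mul_nonneg (mul_nonneg hs ht) (sq_nonneg (x i / a i - y i / a i))]
    calc _ ≤ ∑ i, (s * (x i / a i) ^ 2 + t * (y i / a i) ^ 2) := Finset.sum_le_sum fun i _ => h i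
      _ = s * ∑ i, (x i / a i) ^ 2 + t * ∑ i, (y i / a i) ^ 2 := by
        rw [Finset.sum_add_distrib, Finset.mul_sum, Finset.mul_sum]
      _ ≤ s * 1 + t * 1 := by gcongr <;> assumption
      _ = 1 := by linarith
  isCompact := by
    have hbox : IsCompact ((WithLp.ofLp : EuclideanSpace ℝ (Fin n) → Fin n → ℝ) ⁻¹' Icc (-a) a) :=
      (EuclideanSpace.equiv (Fin n) ℝ).toHomeomorph.isCompact_preimage.2 isCompact_Icc
    exact hbox.of_isClosed_subset (isClosed_le (by fun_prop) continuous_const)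
      (ellipsoid_subset_box ha)
  nonempty_interior := by
    have hsub : {x : EuclideanSpace ℝ (Fin n) | ∑ i, (x i / a i) ^ 2 < 1} ⊆ ellipsoid a := by
      intro x hx
      rw [mem_ofPred_eq] at hx
      exact hx.le
    exact ⟨0, mem_interior.2 ⟨_, hsub, isOpen_lt (by fun_prop) continuous_const, by simp⟩⟩

theorem isCentrallySymmetric_ellipsoid (a : Fin n → ℝ) : IsCentrallySymmetric (ellipsoid a) := by
  intro x hx
  simpa [ellipsoid, neg_div] using hx

/-- A crude bound, from the circumscribed box. -/
theorem volume_ellipsoid_le (ha : ∀ i, 0 < a i) :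
    volume (ellipsoid a) ≤ 2 ^ n * ENNReal.ofReal (∏ i, a i) := by
  refine (measure_mono (ellipsoid_subset_box ha)).trans (le_of_eq ?_)
  rw [(PiLp.volume_preserving_ofLp (Fin n)).measure_preimage measurableSet_Icc.nullMeasurableSet,
    Real.volume_Icc_pi, ENNReal.ofReal_prod_of_nonneg fun i _ => (ha i).le]
  have : ∀ i, ENNReal.ofReal (a i - (-a) i) = 2 * ENNReal.ofReal (a i) := fun i => by
    rw [Pi.neg_apply, sub_neg_eq_add, ← two_mul, ENNReal.ofReal_mul (by norm_num)]
    simp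
  rw [Finset.prod_congr rfl fun i _ => this i, Finset.prod_mul_distrib]
  simp

/-- The mean width of an ellipsoid is at least that of each of its principal axes. -/
theorem axis_mul_average_le_meanWidth_ellipsoid (ha : ∀ i, 0 < a i) (i : Fin n) :
    a i * ⨍ ξ : Metric.sphere (0 : EuclideanSpace ℝ (Fin n)) 1,
      |(ξ : EuclideanSpace ℝ (Fin n)) i| ∂(volume : Measure (EuclideanSpace ℝ (Fin n))).toSphere ≤
      meanWidth (ellipsoid a) := by
  have hE := isConvexBody_ellipsoid ha
  have hmem : EuclideanSpace.single i (a i) ∈ ellipsoid a := by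
    have : ∀ j, (EuclideanSpace.single i (a i) j / a j) ^ 2 = if j = i then 1 else 0 := by
      intro j
      by_cases hj : j = i
      · subst hj; simp [(ha j).ne']
      · simp [hj]
    rw [ellipsoid, mem_ofPred_eq, Finset.sum_congr rfl fun j _ => this j]
    simp
  have hle : ∀ ξ : EuclideanSpace ℝ (Fin n), a i * |ξ i| ≤ supportFunction (ellipsoid a) ξ := by
    intro ξ
    have h1 := inner_le_supportFunction hE.isCompact hmem ξ
    have h2 := inner_le_supportFunction hE.isCompact (isCentrallySymmetric_ellipsoid a _ hmem) ξ
    rw [inner_neg_left] at h2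
    rw [EuclideanSpace.inner_single_left, conj_trivial] at h1 h2
    calc _ = |a i * ξ i| := by rw [abs_mul, abs_of_pos (ha i)]
      _ ≤ _ := abs_le'.2 ⟨h1, h2⟩
  rw [meanWidth, average_eq, average_eq, smul_eq_mul, smul_eq_mul, mul_left_comm,
    ← integral_const_mul]
  refine mul_le_mul_of_nonneg_left (integral_mono ?_ ?_ fun ξ => hle ξ) (by positivity)
  · exact integrable_sphere_of_continuous (by fun_prop)
  · exact integrable_sphere_of_continuous
      ((continuous_supportFunction hE.isCompact).comp continuous_subtype_val)

theorem average_abs_coord_pos (i : Fin n) :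
    0 < ⨍ ξ : Metric.sphere (0 : EuclideanSpace ℝ (Fin n)) 1,
      |(ξ : EuclideanSpace ℝ (Fin n)) i|
        ∂(volume : Measure (EuclideanSpace ℝ (Fin n))).toSphere := by
  have : Nonempty (Fin n) := ⟨i⟩
  have hc : Continuous fun ξ : Metric.sphere (0 : EuclideanSpace ℝ (Fin n)) 1 =>
    |(ξ : EuclideanSpace ℝ (Fin n)) i| := by fun_prop
  rw [average_eq, smul_eq_mul]
  refine mul_pos (inv_pos.2 (ENNReal.toReal_pos ?_ (measure_ne_top _ _))) ?_
  · exact Measure.measure_univ_ne_zero.2 (Measure.toSphere_ne_zero _)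
  · refine hc.integral_pos_of_hasCompactSupport_nonneg_nonzero
      (HasCompactSupport.of_compactSpace _) (fun ξ => abs_nonneg _)
      (x := ⟨EuclideanSpace.single i 1, by simp⟩) ?_
    simp

theorem elongatedAxes_pos {a : ℝ} (ha : 0 < a) (i : Fin n) : 0 < elongatedAxes n a i := by
  unfold elongatedAxes
  split_ifs <;> positivity

theorem prod_elongatedAxes (hn : 1 ≤ n) {a : ℝ} (ha : 0 < a) :
    ∏ i, elongatedAxes n a i = 1 := by
  obtain ⟨m, rfl⟩ : ∃ m, n = m + 1 := ⟨n - 1, by omega⟩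
  rw [Fin.prod_univ_castSucc]
  have h : ∀ i : Fin m, elongatedAxes (m + 1) a i.castSucc = a := fun i => by
    simp [elongatedAxes, i.2.ne]
  have hlast : elongatedAxes (m + 1) a (Fin.last m) = 1 / a ^ m := by simp [elongatedAxes]
  rw [Finset.prod_congr rfl fun i _ => h i, hlast, Finset.prod_const, Finset.card_fin,
    mul_one_div_cancel (pow_ne_zero m ha.ne')]

/-- The volume of the elongated ellipsoids is bounded, so by the isoperimetric inequality the
ratio of their surface area to their volume is bounded below, while their mean width is at least a
constant times the long semi-axis. -/
theorem tendsto_q_elongated_ellipsoid (hn : 2 ≤ n) :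
    Tendsto (fun a : ℝ => q (ellipsoid (elongatedAxes n a))) (𝓝[>] 0) atTop := by
  have hn1 : 1 ≤ n := by omega
  obtain ⟨R, hR, hRV⟩ := exists_pos_volume_closedBall_eq (n := n) hn1 (V := 2 ^ n) (by simp)
    (by simp)
  set i : Fin n := ⟨n - 1, by omega⟩ with hi
  set c := ⨍ ξ : Metric.sphere (0 : EuclideanSpace ℝ (Fin n)) 1,
    |(ξ : EuclideanSpace ℝ (Fin n)) i| ∂(volume : Measure (EuclideanSpace ℝ (Fin n))).toSphere
    with hc
  have hc0 : 0 < c := average_abs_coord_pos i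
  have hlow : ∀ a : ℝ, 0 < a →
      (n / R * c) * (a⁻¹) ^ (n - 1) ≤ q (ellipsoid (elongatedAxes n a)) := by
    intro a ha
    have hE := isConvexBody_ellipsoid (elongatedAxes_pos (n := n) ha)
    have hV : volume (ellipsoid (elongatedAxes n a)) ≤
        volume (Metric.closedBall (0 : EuclideanSpace ℝ (Fin n)) R) := by
      rw [hRV]
      simpa [prod_elongatedAxes hn1 ha] using volume_ellipsoid_le (elongatedAxes_pos (n := n) ha)
    have hS := nat_mul_volume_le_mul_surfaceArea hn1 hE hR hV
    have hw := axis_mul_average_le_meanWidth_ellipsoid (elongatedAxes_pos (n := n) ha) i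
    have hai : elongatedAxes n a i = (a⁻¹) ^ (n - 1) := by
      have : (i : ℕ) + 1 = n := by simp [hi]; omega
      simp [elongatedAxes, this]
    rw [hai] at hw
    have hVpos := hE.volume_real_pos
    have hS' : n / R * (volume : Measure (EuclideanSpace ℝ (Fin n))).real
        (ellipsoid (elongatedAxes n a)) ≤ surfaceArea (ellipsoid (elongatedAxes n a)) := by
      rw [div_mul_eq_mul_div, div_le_iff₀ hR]
      linarith
    rw [q, le_div_iff₀ hVpos]
    calc _ = ((a⁻¹) ^ (n - 1) * c) * (n / R * (volume : Measure (EuclideanSpace ℝ (Fin n))).real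
          (ellipsoid (elongatedAxes n a))) := by ring
      _ ≤ _ := mul_le_mul hw hS' (by positivity) (le_trans (by positivity) hw)
  refine tendsto_atTop_mono' _ (f₁ := fun a : ℝ => (n / R * c) * (a⁻¹) ^ (n - 1)) ?_ ?_
  · filter_upwards [self_mem_nhdsWithin] with a ha using hlow a ha
  · have : 0 < (n : ℝ) / R * c := by positivity
    exact Tendsto.const_mul_atTop this
      ((tendsto_pow_atTop (by omega)).comp tendsto_inv_nhdsGT_zero)

end Ellipsoids

end QParam

theorem mainTheorem9 (n : ℕ) (hn : 2 ≤ n) :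
    (∀ K : Set (EuclideanSpace ℝ (Fin n)), QParam.IsConvexBody K → (n : ℝ) ≤ QParam.q K) ∧
    QParam.q (Metric.closedBall (0 : EuclideanSpace ℝ (Fin n)) 1) = n ∧
    (⨆ K ∈ {K : Set (EuclideanSpace ℝ (Fin n)) |
        QParam.IsConvexBody K ∧ QParam.IsCentrallySymmetric K}, ((QParam.q K : ℝ) : EReal)) = ⊤ ∧
    (∀ a : ℝ, 0 < a → a < 1 →
      QParam.IsConvexBody (QParam.ellipsoid (QParam.elongatedAxes n a)) ∧
      QParam.IsCentrallySymmetric (QParam.ellipsoid (QParam.elongatedAxes n a))) ∧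
    Tendsto (fun a : ℝ => QParam.q (QParam.ellipsoid (QParam.elongatedAxes n a)))
      (𝓝[>] 0) atTop := by
  have hn1 : 1 ≤ n := by omega
  have hbody : ∀ a : ℝ, 0 < a →
      QParam.IsConvexBody (QParam.ellipsoid (QParam.elongatedAxes n a)) ∧
      QParam.IsCentrallySymmetric (QParam.ellipsoid (QParam.elongatedAxes n a)) := fun a ha =>
    ⟨QParam.isConvexBody_ellipsoid (QParam.elongatedAxes_pos ha),
      QParam.isCentrallySymmetric_ellipsoid _⟩
  refine ⟨fun K hK => QParam.le_q hn1 hK, QParam.q_closedBall_one hn1, ?_,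
    fun a ha _ => hbody a ha, QParam.tendsto_q_elongated_ellipsoid hn⟩
  refine (EReal.eq_top_iff_forall_lt _).2 fun y => ?_
  obtain ⟨a, hay, ha⟩ := (((QParam.tendsto_q_elongated_ellipsoid hn).eventually_gt_atTop y).and
    self_mem_nhdsWithin).exists
  exact (EReal.coe_lt_coe hay).trans_le
    (le_iSup₂ (f := fun (K : Set (EuclideanSpace ℝ (Fin n))) _ => ((QParam.q K : ℝ) : EReal))
      _ (hbody a ha))
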